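/- **Theorem (Global convergence of gradient methods for LQR).** Let $A\in\mathbb R^{d\times d}$, $B\in\mathbb R^{d\times k}$, let $Q\in\mathbb R^{d\times d}$ and $R\in\mathbb R^{k\times k}$ be (symmetric) positive definite, and let $\mathcal D$ be a probability distribution on $\mathbb R^d$. For $K\in\mathbb R^{k\times d}$ put $x_0\sim\mathcal D$, $u_t=-Kx_t$, $x_{t+1}=Ax_t+Bu_t$, and $$C(K)=\mathbb E\sum_{t\ge0}\left(x_t^\top Qx_t+u_t^\top Ru_t\right)\in[0,\infty],\qquad \Sigma_K=\mathbb E\sum_{t\ge0}x_tx_t^\top .$$ Let $P_K$ be the solution of $P=Q+K^\top RK+(A-BK)^\top P(A-BK)$, let $\nabla C(K)$ be the matrix of partial derivatives of $C$ in the entries of $K$, let $K^*$ be a minimizer of $C$, let $\|\cdot\|$ be the spectral norm, $\sigma_{\min}$ the smallest singular value, and $\mu=\sigma_{\min}(\mathbb E\,x_0x_0^\top)$. Suppose $C(K_0)<\infty$ and $\mu>0$, and let $\varepsilon>0$. 1. (Gauss–Newton) For $K_{n+1}=K_n-\eta\,(R+B^\top P_{K_n}B)^{-1}\,\tfrac12\nabla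 C(K_n)\,\Sigma_{K_n}^{-1}$ with $\eta=1$, every integer $N\ge0$ with $$N\ge\frac{\|\Sigma_{K^*}\|}{\mu}\log\frac{C(K_0)-C(K^*)}{\varepsilon}$$ satisfies $C(K_N)-C(K^*)\le\varepsilon$. 2. (Natural policy gradient) For $K_{n+1}=K_n-\eta\,\tfrac12\nabla C(K_n)\,\Sigma_{K_n}^{-1}$ with $\eta=1\big/\left(\|R\|+\|B\|^2C(K_0)/\mu\right)$, every integer $N\ge0$ with $$N\ge\frac{\|\Sigma_{K^*}\|}{\mu}\left(\frac{\|R\|}{\sigma_{\min}(R)}+\frac{\|B\|^2C(K_0)}{\mu\,\sigma_{\min}(R)}\right)\log\frac{C(K_0)-C(K^*)}{\varepsilon}$$ satisfies $C(K_N)-C(K^*)\le\varepsilon$. 3. (Gradient descent) There are real polynomials $p$ (in 7 variables) and $q$ (in 6 variables), which are universal, i.e. the same for all $d,k,A,B,Q,R,\mathcal D,K_0,\varepsilon$, such that for $K_{n+1}=K_n-\eta\nabla C(K_n)$ with the constant step size $$\eta=\frac1{p\left(C(K_0),\frac1\mu,\frac1{\sigma_{\min}(Q)},\|A\|,\|B\|,\|R\|,\frac1{\sigma_{\min}(R)}\right)}>0,$$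 every integer $N\ge0$ with $$N\ge\frac{\|\Sigma_{K^*}\|}{\mu}\,\log\frac{C(K_0)-C(K^*)}{\varepsilon}\;\,q\left(\frac{C(K_0)}{\mu\,\sigma_{\min}(Q)},\frac{C(K_0)}{\mu},\|A\|,\|B\|,\|R\|,\frac1{\sigma_{\min}(R)}\right)$$ satisfies $C(K_N)-C(K^*)\le\varepsilon$. In all three cases $C(K_N)$ is finite. Here $1/0$, a quotient with denominator $0$, and $\log 0$ are read as $0$ (they occur only if $k=0$ or $C(K_0)=C(K^*)$). -/

import Mathlib

open MeasureTheory Matrix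
open scoped ENNReal Matrix.Norms.L2Operator

noncomputable section

/-- The smallest singular value of a square matrix. Singular values are indexed from `0` in
decreasing order, so that the last one of an `n × n` matrix has index `n - 1`. -/
def sigmaMin {n : ℕ} (Z : Matrix (Fin n) (Fin n) ℝ) : ℝ :=
  (Matrix.toEuclideanLin Z).singularValues (n - 1)

/-- The data of an infinite horizon LQR problem with `d`-dimensional states and `k`-dimensional
controls: system matrices, cost matrices and the distribution of the initial state. -/
structure LQR (d k : ℕ) where
  A : Matrix (Fin d) (Fin d) ℝ
  B : Matrix (Fin d) (Fin k) ℝ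
  Q : Matrix (Fin d) (Fin d) ℝ
  R : Matrix (Fin k) (Fin k) ℝ
  D : Measure (Fin d → ℝ)

namespace LQR

variable {d k : ℕ}

/-- The state `x_t` reached from `x_0` when the controls are `u_t = -K x_t`. -/
def state (S : LQR d k) (K : Matrix (Fin k) (Fin d) ℝ) (x₀ : Fin d → ℝ) : ℕ → Fin d → ℝ
  | 0 => x₀
  | t + 1 => S.A *ᵥ S.state K x₀ t + S.B *ᵥ (-(K *ᵥ S.state K x₀ t))

/-- The control `u_t = -K x_t`. -/
def control (S : LQR d k) (K : Matrix (Fin k) (Fin d) ℝ) (x₀ : Fin d → ℝ) (t : ℕ) : Fin k → ℝ :=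
  -(K *ᵥ S.state K x₀ t)

/-- The cost `C(K) = E ∑ₜ (xₜᵀ Q xₜ + uₜᵀ R uₜ)`, with values in `[0, ∞]`. -/
def cost (S : LQR d k) (K : Matrix (Fin k) (Fin d) ℝ) : ℝ≥0∞ :=
  ∫⁻ x₀, ∑' t : ℕ, ENNReal.ofReal
    (S.state K x₀ t ⬝ᵥ (S.Q *ᵥ S.state K x₀ t) +
      S.control K x₀ t ⬝ᵥ (S.R *ᵥ S.control K x₀ t)) ∂S.D

/-- The cost as a real number (used where it is finite). -/
def costR (S : LQR d k) (K : Matrix (Fin k) (Fin d) ℝ) : ℝ := (S.cost K).toReal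

/-- The gradient `∇C(K)`: the matrix of the partial derivatives of `C` in the entries of `K`. -/
def grad (S : LQR d k) (K : Matrix (Fin k) (Fin d) ℝ) : Matrix (Fin k) (Fin d) ℝ :=
  Matrix.of fun i j => deriv (fun s : ℝ => S.costR (K + s • Matrix.single i j (1 : ℝ))) 0

/-- `P_K`: the solution of `P = Q + Kᵀ R K + (A - B K)ᵀ P (A - B K)`
(it is unique as soon as `A - B K` is stable). -/
def valueMatrix (S : LQR d k) (K : Matrix (Fin k) (Fin d) ℝ) : Matrix (Fin d) (Fin d) ℝ :=
  Classical.epsilon fun P : Matrix (Fin d) (Fin d) ℝ =>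
    P = S.Q + Kᵀ * S.R * K + (S.A - S.B * K)ᵀ * P * (S.A - S.B * K)

/-- The state correlation matrix `Σ_K = E ∑ₜ xₜ xₜᵀ`. -/
def stateCorr (S : LQR d k) (K : Matrix (Fin k) (Fin d) ℝ) : Matrix (Fin d) (Fin d) ℝ :=
  Matrix.of fun i j => ∫ x₀, ∑' t : ℕ, S.state K x₀ t i * S.state K x₀ t j ∂S.D

/-- The second moment matrix `E x₀ x₀ᵀ` of the initial state. -/
def secondMoment (S : LQR d k) : Matrix (Fin d) (Fin d) ℝ :=
  Matrix.of fun i j => ∫ x₀, x₀ i * x₀ j ∂S.D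

/-- `μ = σ_min(E x₀ x₀ᵀ)`. -/
def mu (S : LQR d k) : ℝ := sigmaMin S.secondMoment

/-- One step of gradient descent. -/
def gdStep (S : LQR d k) (η : ℝ) (K : Matrix (Fin k) (Fin d) ℝ) : Matrix (Fin k) (Fin d) ℝ :=
  K - η • S.grad K

/-- One step of natural policy gradient descent, with the gradient normalized as `∇C(K) / 2`. -/
def npgStep (S : LQR d k) (η : ℝ) (K : Matrix (Fin k) (Fin d) ℝ) : Matrix (Fin k) (Fin d) ℝ :=
  K - η • (((1 / 2 : ℝ) • S.grad K) * (S.stateCorr K)⁻¹)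

/-- One step of the Gauss-Newton method, with the gradient normalized as `∇C(K) / 2`
(so that `η = 1` is policy iteration). -/
def gnStep (S : LQR d k) (η : ℝ) (K : Matrix (Fin k) (Fin d) ℝ) : Matrix (Fin k) (Fin d) ℝ :=
  K - η • ((S.R + S.Bᵀ * S.valueMatrix K * S.B)⁻¹ * ((1 / 2 : ℝ) • S.grad K) *
    (S.stateCorr K)⁻¹)

end LQR

end

/-! Write M = A - BK, Σ = `stateCorr K`, P = `valueMatrix K`, G = E x₀x₀ᵀ. Finite cost is equivalent
to stability of M, and then Σ and P are the solutions of two dual Lyapunov equations, with C(K) =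
tr((Q + KᵀRK) Σ) = tr(P G).

The cost is not convex in K, but differences of costs are exact: C(K') - C(K) = tr(V Σ_{K'}), where
the Bellman defect V is quadratic in Δ = K' - K, namely V = ΔᵀE + EᵀΔ + ΔᵀρΔ with ρ = R + BᵀPB and E
= `gradFactor K` (`Regular.costR_sub`, `Regular.bellmanDefect_eq`). Everything is read off from
this. Its first order part gives ∇C = 2EΣ. Completing the square, V ≥ -Eᵀρ⁻¹E for every K', so the
optimality gap is at most ‖Σ_{K*}‖ tr(Eᵀρ⁻¹E) (gradient domination).

Conversely, a step with V ≤ -W ≤ 0 makes P a Lyapunov certificate for K', so K' is stabilizing, and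
it lowers the cost by at least μ tr W (`Regular.descent`). Gauss–Newton and natural gradient steps
are of this kind. For gradient descent Δ = -2ηEΣ and V need not have a sign; instead Σ_{K'} is shown
to be close to Σ (`SqSummable.perturb`), and the trace of V Σ_{K'} is estimated. The step size
needed is bounded below by a polynomial expression uniformly on the sublevel set of K₀, which the
iteration never leaves.

Decrease and domination together contract the optimality gap by 1 - 1/L ≤ exp(-1/L) per step, hence
the logarithmic iteration counts. -/

set_option linter.unusedSectionVars false

/-! ### Loewner order, trace and spectral norm of real matrices -/

section MatrixTools

open scoped MatrixOrder

variable {m n : Type*} [Fintype m] [Fintype n] [DecidableEq m] [DecidableEq n]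

namespace Matrix

theorem l2_opNorm_transpose (Z : Matrix m n ℝ) : ‖Zᵀ‖ = ‖Z‖ := by
  rw [← conjTranspose_eq_transpose_of_trivial, l2_opNorm_conjTranspose]

theorem l2_opNorm_transpose_mul_self (Z : Matrix m n ℝ) : ‖Zᵀ * Z‖ = ‖Z‖ ^ 2 := by
  rw [← conjTranspose_eq_transpose_of_trivial, l2_opNorm_conjTranspose_mul_self, sq]

theorem l2_opNorm_mul_transpose_self (Z : Matrix m n ℝ) : ‖Z * Zᵀ‖ = ‖Z‖ ^ 2 := by
  simpa [l2_opNorm_transpose] using l2_opNorm_transpose_mul_self Zᵀ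

theorem nonneg_iff_dotProduct {Z : Matrix n n ℝ} :
    0 ≤ Z ↔ Zᵀ = Z ∧ ∀ x, 0 ≤ x ⬝ᵥ Z *ᵥ x := by
  rw [nonneg_iff_posSemidef, posSemidef_iff_dotProduct_mulVec, IsHermitian,
    conjTranspose_eq_transpose_of_trivial]
  simp

theorem transpose_eq_of_nonneg {Z : Matrix n n ℝ} (hZ : 0 ≤ Z) : Zᵀ = Z :=
  (nonneg_iff_dotProduct.1 hZ).1

theorem le_iff_dotProduct {Z W : Matrix n n ℝ} (hZ : Zᵀ = Z) (hW : Wᵀ = W) :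
    Z ≤ W ↔ ∀ x, x ⬝ᵥ Z *ᵥ x ≤ x ⬝ᵥ W *ᵥ x := by
  rw [← sub_nonneg, nonneg_iff_dotProduct]
  simp [hZ, hW, sub_mulVec]

theorem dotProduct_le_of_le {Z W : Matrix n n ℝ} (h : Z ≤ W) (x : n → ℝ) :
    x ⬝ᵥ Z *ᵥ x ≤ x ⬝ᵥ W *ᵥ x := by
  have := (nonneg_iff_dotProduct.1 (sub_nonneg.2 h)).2 x
  simpa [sub_mulVec] using this

theorem smul_le_smul_left_of_nonneg {Z W : Matrix n n ℝ} {a : ℝ} (ha : 0 ≤ a) (h : Z ≤ W) :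
    a • Z ≤ a • W := by
  rw [le_iff, ← smul_sub]
  exact PosSemidef.smul (le_iff.1 h) ha

theorem smul_le_smul_right_of_nonneg {Z : Matrix n n ℝ} {a b : ℝ} (hZ : 0 ≤ Z) (h : a ≤ b) :
    a • Z ≤ b • Z := by
  rw [le_iff, ← sub_smul]
  exact PosSemidef.smul hZ.posSemidef (sub_nonneg.2 h)

theorem smul_nonneg_of_nonneg {Z : Matrix n n ℝ} {a : ℝ} (ha : 0 ≤ a) (hZ : 0 ≤ Z) :
    0 ≤ a • Z := (PosSemidef.smul hZ.posSemidef ha).nonneg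

theorem one_nonneg' : (0 : Matrix n n ℝ) ≤ 1 := PosSemidef.one.nonneg

theorem conj_nonneg {Z : Matrix n n ℝ} (hZ : 0 ≤ Z) (M : Matrix m n ℝ) : 0 ≤ M * Z * Mᵀ := by
  rw [← conjTranspose_eq_transpose_of_trivial]
  exact (hZ.posSemidef.mul_mul_conjTranspose_same M).nonneg

theorem conj_nonneg' {Z : Matrix n n ℝ} (hZ : 0 ≤ Z) (M : Matrix n m ℝ) : 0 ≤ Mᵀ * Z * M := by
  simpa using conj_nonneg hZ Mᵀ

theorem transpose_mul_self_nonneg (M : Matrix m n ℝ) : 0 ≤ Mᵀ * M := by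
  simpa using conj_nonneg' one_nonneg' M

theorem conj_mono {Z W : Matrix n n ℝ} (h : Z ≤ W) (M : Matrix m n ℝ) :
    M * Z * Mᵀ ≤ M * W * Mᵀ := by
  rw [← sub_nonneg, ← Matrix.sub_mul, ← Matrix.mul_sub]
  exact conj_nonneg (sub_nonneg.2 h) M

theorem conj_mono' {Z W : Matrix n n ℝ} (h : Z ≤ W) (M : Matrix n m ℝ) :
    Mᵀ * Z * M ≤ Mᵀ * W * M := by
  simpa using conj_mono h Mᵀ

theorem exists_eq_transpose_mul_self {Z : Matrix n n ℝ} (hZ : 0 ≤ Z) :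
    ∃ Y : Matrix n n ℝ, Z = Yᵀ * Y := by
  obtain ⟨Y, hY⟩ := CStarAlgebra.nonneg_iff_eq_star_mul_self.1 hZ
  exact ⟨Y, by rw [hY, star_eq_conjTranspose, conjTranspose_eq_transpose_of_trivial]⟩

theorem trace_mul_nonneg {Z W : Matrix n n ℝ} (hZ : 0 ≤ Z) (hW : 0 ≤ W) :
    0 ≤ (Z * W).trace := by
  obtain ⟨Y, rfl⟩ := exists_eq_transpose_mul_self hZ
  rw [Matrix.mul_assoc, trace_mul_comm]
  exact (conj_nonneg hW Y).posSemidef.trace_nonneg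

theorem trace_mul_mono_left {Z W V : Matrix n n ℝ} (h : Z ≤ W) (hV : 0 ≤ V) :
    (Z * V).trace ≤ (W * V).trace := by
  have := trace_mul_nonneg (sub_nonneg.2 h) hV
  rw [Matrix.sub_mul, trace_sub] at this
  linarith

theorem trace_mul_mono_right {Z W V : Matrix n n ℝ} (h : Z ≤ W) (hV : 0 ≤ V) :
    (V * Z).trace ≤ (V * W).trace := by
  rw [trace_mul_comm V, trace_mul_comm V]
  exact trace_mul_mono_left h hV

theorem trace_nonneg_of_nonneg {Z : Matrix n n ℝ} (hZ : 0 ≤ Z) : 0 ≤ Z.trace :=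
  hZ.posSemidef.trace_nonneg

theorem norm_toLp_mulVec_le (Z : Matrix m n ℝ) (x : EuclideanSpace ℝ n) :
    ‖WithLp.toLp 2 (Z *ᵥ x.ofLp)‖ ≤ ‖Z‖ * ‖x‖ := l2_opNorm_mulVec Z x

theorem dotProduct_self_eq_norm_sq (x : n → ℝ) : x ⬝ᵥ x = ‖WithLp.toLp 2 x‖ ^ 2 := by
  rw [EuclideanSpace.real_norm_sq_eq]
  simp [dotProduct, sq]

theorem abs_dotProduct_mulVec_le (Z : Matrix m n ℝ) (y : m → ℝ) (x : n → ℝ) :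
    |y ⬝ᵥ Z *ᵥ x| ≤ ‖Z‖ * ‖WithLp.toLp 2 x‖ * ‖WithLp.toLp 2 y‖ := by
  have h := abs_real_inner_le_norm (WithLp.toLp 2 (Z *ᵥ x)) (WithLp.toLp 2 y)
  rw [EuclideanSpace.inner_toLp_toLp] at h
  simp only [star_trivial] at h
  exact h.trans (mul_le_mul_of_nonneg_right (norm_toLp_mulVec_le Z (WithLp.toLp 2 x))
    (norm_nonneg _))

theorem le_norm_smul_one {Z : Matrix n n ℝ} (hZ : Zᵀ = Z) : Z ≤ ‖Z‖ • 1 := by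
  rw [le_iff_dotProduct hZ (by simp)]
  intro x
  have h := (le_abs_self _).trans (abs_dotProduct_mulVec_le Z x x)
  simp only [smul_mulVec, one_mulVec, dotProduct_smul, smul_eq_mul, dotProduct_self_eq_norm_sq x]
  linarith

theorem neg_norm_smul_one_le {Z : Matrix n n ℝ} (hZ : Zᵀ = Z) : -(‖Z‖ • 1) ≤ Z := by
  have := le_norm_smul_one (Z := -Z) (by simp [hZ])
  rw [norm_neg] at this
  exact neg_le.1 this

theorem norm_le_of_dotProduct_le {Y : Matrix m n ℝ} {c : ℝ} (hc : 0 ≤ c)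
    (h : Yᵀ * Y ≤ c • 1) : ‖Y‖ ^ 2 ≤ c := by
  have : ‖Y‖ ≤ √c := by
    rw [l2_opNorm_def]
    refine ContinuousLinearMap.opNorm_le_bound _ (Real.sqrt_nonneg c) fun x => ?_
    have hx := dotProduct_le_of_le h x.ofLp
    rw [← mulVec_mulVec, dotProduct_mulVec, vecMul_transpose, dotProduct_self_eq_norm_sq] at hx
    simp only [smul_mulVec, one_mulVec, dotProduct_smul, smul_eq_mul,
      dotProduct_self_eq_norm_sq x.ofLp] at hx
    rw [← abs_of_nonneg (norm_nonneg x), ← Real.sqrt_sq_eq_abs, ← Real.sqrt_mul hc]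
    exact Real.le_sqrt_of_sq_le hx
  calc ‖Y‖ ^ 2 ≤ √c ^ 2 := by gcongr
    _ = c := Real.sq_sqrt hc

theorem norm_le_of_le_smul_one {Z : Matrix n n ℝ} {c : ℝ} (hc : 0 ≤ c) (hZ : 0 ≤ Z)
    (h : Z ≤ c • 1) : ‖Z‖ ≤ c := by
  obtain ⟨Y, rfl⟩ := exists_eq_transpose_mul_self hZ
  rw [l2_opNorm_transpose_mul_self]
  exact norm_le_of_dotProduct_le hc h

theorem norm_mono {Z W : Matrix n n ℝ} (hZ : 0 ≤ Z) (h : Z ≤ W) : ‖Z‖ ≤ ‖W‖ :=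
  norm_le_of_le_smul_one (norm_nonneg _) hZ
    (h.trans (le_norm_smul_one (transpose_eq_of_nonneg (hZ.trans h))))

/-- Cauchy–Schwarz on each row of a factor Y with Z = YᵀY. Bounding norms by traces keeps all later
constants free of the dimension. -/
theorem le_trace_smul_one {Z : Matrix n n ℝ} (hZ : 0 ≤ Z) : Z ≤ Z.trace • 1 := by
  rw [le_iff_dotProduct (transpose_eq_of_nonneg hZ) (by simp)]
  intro x
  obtain ⟨Y, rfl⟩ := exists_eq_transpose_mul_self hZ
  rw [← mulVec_mulVec, dotProduct_mulVec, vecMul_transpose]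
  simp only [smul_mulVec, one_mulVec, dotProduct_smul, smul_eq_mul]
  simp only [trace, diag, mul_apply, transpose_apply]
  rw [Finset.sum_comm, dotProduct, Finset.sum_mul]
  refine Finset.sum_le_sum fun i _ => ?_
  simp only [mulVec, dotProduct]
  have := Finset.sum_mul_sq_le_sq_mul_sq Finset.univ (Y i) x
  simpa only [sq] using this

theorem norm_le_trace {Z : Matrix n n ℝ} (hZ : 0 ≤ Z) : ‖Z‖ ≤ Z.trace :=
  norm_le_of_le_smul_one (trace_nonneg_of_nonneg hZ) hZ (le_trace_smul_one hZ)

theorem nonneg_of_hasSum {f : ℕ → Matrix n n ℝ} {Z : Matrix n n ℝ} (h : HasSum f Z)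
    (hf : ∀ t, 0 ≤ f t) : 0 ≤ Z := by
  rw [nonneg_iff_dotProduct]
  constructor
  · refine h.matrix_transpose.unique ?_
    simpa only [transpose_eq_of_nonneg (hf _)] using h
  · intro x
    have hc : Continuous fun W : Matrix n n ℝ => x ⬝ᵥ W *ᵥ x := by fun_prop
    have h' := h.map (AddMonoidHom.mk' (fun W : Matrix n n ℝ => x ⬝ᵥ W *ᵥ x)
      (fun U V => by simp [add_mulVec])) hc
    exact h'.nonneg fun t => (nonneg_iff_dotProduct.1 (hf t)).2 x

end Matrix

end MatrixTools

/-! ### Smallest singular value as a lower bound in the Loewner order -/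

section SigmaMin

open scoped MatrixOrder

theorem sigmaMin_nonneg {n : ℕ} (Z : Matrix (Fin n) (Fin n) ℝ) : 0 ≤ sigmaMin Z :=
  LinearMap.singularValues_nonneg _ _

theorem sigmaMin_pos {n : ℕ} (hn : 0 < n) {Z : Matrix (Fin n) (Fin n) ℝ} (hZ : Z.PosDef) :
    0 < sigmaMin Z := by
  refine (LinearMap.injective_iff_forall_lt_finrank_singularValues_pos _).1 ?_ _ ?_
  · intro x y hxy
    have h : Z *ᵥ x.ofLp = Z *ᵥ y.ofLp := congrArg WithLp.ofLp hxy
    exact WithLp.ofLp_injective 2 (mulVec_injective_of_isUnit hZ.isUnit h)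
  · rw [finrank_euclideanSpace_fin]; omega

theorem pos_of_sigmaMin_pos {n : ℕ} {Z : Matrix (Fin n) (Fin n) ℝ} (h : 0 < sigmaMin Z) :
    0 < n := by
  by_contra hn
  refine h.ne' (LinearMap.singularValues_of_finrank_le _ ?_)
  rw [finrank_euclideanSpace_fin]; omega

/-- An eigenvalue of Z is nonnegative and its square is an eigenvalue of ZᵀZ, so it is itself a
singular value, hence at least the last one. The eigenvalues are taken for the shifted matrix Z -
σ_min(Z), where the claim is their nonnegativity. -/
theorem sigmaMin_smul_one_le {n : ℕ} {Z : Matrix (Fin n) (Fin n) ℝ} (hZ : 0 ≤ Z) :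
    sigmaMin Z • 1 ≤ Z := by
  have hZt := transpose_eq_of_nonneg hZ
  have hh : (Z - sigmaMin Z • 1).IsHermitian := by
    rw [IsHermitian, conjTranspose_eq_transpose_of_trivial]; simp [hZt]
  rw [Matrix.le_iff, hh.posSemidef_iff_eigenvalues_nonneg]
  intro i
  have hv := hh.mulVec_eigenvectorBasis i
  set τ := hh.eigenvalues i with hτ
  set v := hh.eigenvectorBasis i with hvdef
  have hv0 : v ≠ 0 := hh.eigenvectorBasis.orthonormal.ne_zero i
  have hZv : Z *ᵥ v.ofLp = (τ + sigmaMin Z) • v.ofLp := by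
    rw [sub_mulVec, smul_mulVec, one_mulVec, sub_eq_iff_eq_add] at hv
    rw [hv, add_smul]
  have hpos : 0 ≤ τ + sigmaMin Z := by
    have h1 := (nonneg_iff_dotProduct.1 hZ).2 v.ofLp
    rw [hZv, dotProduct_smul, smul_eq_mul, dotProduct_self_eq_norm_sq] at h1
    have h2 : 0 < ‖WithLp.toLp 2 v.ofLp‖ ^ 2 := by
      have : 0 < ‖v‖ := norm_pos_iff.2 hv0
      positivity
    exact nonneg_of_mul_nonneg_left h1 h2
  set T := Matrix.toEuclideanLin Z with hT
  have hTv : T v = (τ + sigmaMin Z) • v := by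
    apply WithLp.ofLp_injective 2
    exact hZv
  have hadj : LinearMap.adjoint T = T := by
    rw [hT, ← Matrix.toEuclideanLin_conjTranspose_eq_adjoint,
      conjTranspose_eq_transpose_of_trivial, hZt]
  have hE : Module.End.HasEigenvalue (LinearMap.adjoint T ∘ₗ T) ((τ + sigmaMin Z) ^ 2) := by
    refine Module.End.hasEigenvalue_of_hasEigenvector (x := v) ⟨?_, hv0⟩
    rw [Module.End.mem_eigenspace_iff, LinearMap.comp_apply, hadj, hTv, map_smul, hTv, smul_smul,
      sq]
  obtain ⟨j, hj⟩ := T.isSymmetric_adjoint_comp_self.exists_eigenvalues_eq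
    (finrank_euclideanSpace_fin (𝕜 := ℝ) (n := n)) hE
  have hj' : T.singularValues j ^ 2 = (τ + sigmaMin Z) ^ 2 := by
    rw [T.sq_singularValues_fin (finrank_euclideanSpace_fin (𝕜 := ℝ) (n := n))]
    exact_mod_cast hj
  have hle : sigmaMin Z ≤ T.singularValues j :=
    T.singularValues_antitone (by have := j.2; omega)
  have := (sq_eq_sq₀ (T.singularValues_nonneg j) hpos).1 hj'
  show 0 ≤ τ
  linarith

end SigmaMin

/-! ### Discrete Lyapunov equations: uniqueness, comparison, duality, perturbation -/

section Lyapunov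

open scoped MatrixOrder

variable {n : Type*} [Fintype n] [DecidableEq n] {M M' W G Z : Matrix n n ℝ}

/-- Square summability of the powers of a matrix, which is equivalent to its stability. -/
def SqSummable (M : Matrix n n ℝ) : Prop := Summable fun t : ℕ => ‖M ^ t‖ ^ 2

/-- The solution `Z = ∑ₜ Mᵗ W (Mᵗ)ᵀ` of the discrete Lyapunov equation `Z = W + M Z Mᵀ`. -/
noncomputable def lyap (M W : Matrix n n ℝ) : Matrix n n ℝ := ∑' t : ℕ, M ^ t * W * (M ^ t)ᵀ

theorem SqSummable.transpose (h : SqSummable M) : SqSummable Mᵀ := by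
  unfold SqSummable
  simp only [← transpose_pow, l2_opNorm_transpose]
  exact h

theorem norm_conj_le (M W : Matrix n n ℝ) : ‖M * W * Mᵀ‖ ≤ ‖M‖ ^ 2 * ‖W‖ := by
  calc ‖M * W * Mᵀ‖ ≤ ‖M‖ * ‖W‖ * ‖Mᵀ‖ :=
        (norm_mul_le _ _).trans (mul_le_mul_of_nonneg_right (norm_mul_le _ _) (norm_nonneg _))
    _ = _ := by rw [l2_opNorm_transpose]; ring

theorem SqSummable.summable (h : SqSummable M) (W : Matrix n n ℝ) :
    Summable fun t : ℕ => M ^ t * W * (M ^ t)ᵀ :=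
  Summable.of_norm_bounded (Summable.mul_right ‖W‖ h) fun t => norm_conj_le (M ^ t) W

theorem SqSummable.hasSum_lyap (h : SqSummable M) (W : Matrix n n ℝ) :
    HasSum (fun t : ℕ => M ^ t * W * (M ^ t)ᵀ) (lyap M W) := (h.summable W).hasSum

theorem pow_succ_conj (M W : Matrix n n ℝ) (t : ℕ) :
    M ^ (t + 1) * W * (M ^ (t + 1))ᵀ = M * (M ^ t * W * (M ^ t)ᵀ) * Mᵀ := by
  rw [pow_succ', transpose_mul]; simp only [Matrix.mul_assoc]

theorem pow_succ_conj' (M W : Matrix n n ℝ) (t : ℕ) :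
    M ^ (t + 1) * W * (M ^ (t + 1))ᵀ = M ^ t * (M * W * Mᵀ) * (M ^ t)ᵀ := by
  rw [pow_succ, transpose_mul]; simp only [Matrix.mul_assoc]

theorem SqSummable.lyap_eq (h : SqSummable M) (W : Matrix n n ℝ) :
    lyap M W = W + M * lyap M W * Mᵀ := by
  have h1 := (h.summable W).tsum_eq_zero_add
  have h2 : HasSum (fun t : ℕ => M ^ (t + 1) * W * (M ^ (t + 1))ᵀ) (M * lyap M W * Mᵀ) := by
    simp only [pow_succ_conj]
    exact ((h.hasSum_lyap W).mul_left M).mul_right Mᵀ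
  rw [h2.tsum_eq] at h1
  change lyap M W = _ at h1
  simpa using h1

/-- The difference D of two solutions satisfies D = Mᵗ D (Mᵗ)ᵀ for all t, and the right side tends
to 0. -/
theorem SqSummable.eq_lyap (h : SqSummable M) (hZ : Z = W + M * Z * Mᵀ) : Z = lyap M W := by
  have hD : Z - lyap M W = M * (Z - lyap M W) * Mᵀ := by
    conv_lhs => rw [hZ, h.lyap_eq W]
    rw [Matrix.mul_sub, Matrix.sub_mul]; abel
  set D := Z - lyap M W with hDdef
  have hpow : ∀ t : ℕ, D = M ^ t * D * (M ^ t)ᵀ := by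
    intro t
    induction t with
    | zero => simp
    | succ t ih => rw [pow_succ_conj', ← hD, ← ih]
  have ht := (h.summable D).tendsto_atTop_zero
  simp only [← hpow] at ht
  have := tendsto_nhds_unique tendsto_const_nhds ht
  exact sub_eq_zero.1 this

theorem SqSummable.lyap_nonneg (h : SqSummable M) (hW : 0 ≤ W) : 0 ≤ lyap M W :=
  nonneg_of_hasSum (h.hasSum_lyap W) fun t => conj_nonneg hW (M ^ t)

theorem SqSummable.lyap_add (h : SqSummable M) (W V : Matrix n n ℝ) :
    lyap M (W + V) = lyap M W + lyap M V := by
  refine (h.eq_lyap ?_).symm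
  conv_lhs => rw [h.lyap_eq W, h.lyap_eq V]
  rw [Matrix.mul_add, Matrix.add_mul]; abel

theorem SqSummable.lyap_smul (h : SqSummable M) (a : ℝ) (W : Matrix n n ℝ) :
    lyap M (a • W) = a • lyap M W := by
  refine (h.eq_lyap ?_).symm
  conv_lhs => rw [h.lyap_eq W]
  simp

theorem SqSummable.le_lyap_self (h : SqSummable M) (hW : 0 ≤ W) : W ≤ lyap M W := by
  rw [h.lyap_eq W]
  exact le_add_of_nonneg_right (conj_nonneg (h.lyap_nonneg hW) M)

/-- A supersolution solves the equation exactly once its slack is added to W, and the solution is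
monotone in W. `SqSummable.le_lyap` is the same for subsolutions. -/
theorem SqSummable.lyap_le (h : SqSummable M) (hZ : W + M * Z * Mᵀ ≤ Z) : lyap M W ≤ Z := by
  have h1 := h.eq_lyap (Z := Z) (W := W + (Z - (W + M * Z * Mᵀ))) (by abel)
  rw [h1, h.lyap_add]
  exact le_add_of_nonneg_right (h.lyap_nonneg (sub_nonneg.2 hZ))

theorem SqSummable.le_lyap (h : SqSummable M) (hZ : Z ≤ W + M * Z * Mᵀ) : Z ≤ lyap M W := by
  have h1 := h.eq_lyap (Z := Z) (W := W - ((W + M * Z * Mᵀ) - Z)) (by abel)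
  have h2 := h.lyap_add (W - ((W + M * Z * Mᵀ) - Z)) ((W + M * Z * Mᵀ) - Z)
  rw [sub_add_cancel, ← h1] at h2
  rw [h2]
  exact le_add_of_nonneg_right (h.lyap_nonneg (sub_nonneg.2 hZ))

theorem norm_pow_sq_le_trace {c : ℝ} (hc : 0 < c) (hW : c • 1 ≤ W) (M : Matrix n n ℝ) :
    ‖M‖ ^ 2 ≤ c⁻¹ * (M * W * Mᵀ).trace := by
  have h1 := conj_mono hW M
  have h2 : M * (c • (1 : Matrix n n ℝ)) * Mᵀ = c • (M * Mᵀ) := by simp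
  rw [h2] at h1
  have h0 : 0 ≤ c • (M * Mᵀ) :=
    smul_nonneg_of_nonneg hc.le (by simpa using conj_nonneg one_nonneg' M)
  have h3 := (norm_mono h0 h1).trans (norm_le_trace (h0.trans h1))
  rw [norm_smul, l2_opNorm_mul_transpose_self, Real.norm_of_nonneg hc.le] at h3
  rwa [le_inv_mul_iff₀ hc]

theorem sqSummable_of_summable_trace {c : ℝ} (hc : 0 < c) (hW : c • 1 ≤ W)
    (h : Summable fun t : ℕ => (M ^ t * W * (M ^ t)ᵀ).trace) : SqSummable M :=
  Summable.of_nonneg_of_le (fun _ => sq_nonneg _)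
    (fun t => norm_pow_sq_le_trace hc hW (M ^ t)) (h.mul_left c⁻¹)

/-- Lyapunov's criterion: iterating the inequality bounds every partial sum of c Mᵗ(Mᵗ)ᵀ by Z, so
the traces are summable. -/
theorem sqSummable_of_lyap_le {c : ℝ} (hc : 0 < c) (hZ : 0 ≤ Z)
    (h : c • 1 + M * Z * Mᵀ ≤ Z) : SqSummable M := by
  refine sqSummable_of_summable_trace hc le_rfl ?_
  refine summable_of_sum_range_le (c := Z.trace) (fun _ => ?_) fun T => ?_
  · exact trace_nonneg_of_nonneg (conj_nonneg (smul_nonneg_of_nonneg hc.le one_nonneg') _)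
  · have key : ∑ t ∈ Finset.range T, M ^ t * (c • 1) * (M ^ t)ᵀ + M ^ T * Z * (M ^ T)ᵀ ≤ Z := by
      induction T with
      | zero => simp
      | succ T ih =>
        refine le_trans ?_ ih
        rw [Finset.sum_range_succ, add_assoc, pow_succ_conj', ← Matrix.add_mul, ← Matrix.mul_add]
        gcongr
        exact conj_mono h _
    have h1 := (le_add_of_nonneg_right (conj_nonneg hZ (M ^ T))).trans key
    have h2 := trace_nonneg_of_nonneg (sub_nonneg.2 h1)
    rw [trace_sub, trace_sum] at h2
    linarith

/-- The maps Z ↦ MZMᵀ and P ↦ MᵀPM are adjoint for the trace pairing. This yields the two formulas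
for the cost, through Σ and through P. -/
theorem SqSummable.trace_mul_lyap (h : SqSummable M) (S G : Matrix n n ℝ) :
    (S * lyap M G).trace = (lyap Mᵀ S * G).trace := by
  have hP := h.transpose.lyap_eq S
  have hZ := h.lyap_eq G
  rw [transpose_transpose] at hP
  set P := lyap Mᵀ S
  set Z := lyap M G
  have hS : S = P - Mᵀ * P * M := by rw [eq_sub_iff_add_eq]; exact hP.symm
  have hG : G = Z - M * Z * Mᵀ := by rw [eq_sub_iff_add_eq]; exact hZ.symm
  rw [hS, hG, Matrix.sub_mul, Matrix.mul_sub, trace_sub, trace_sub]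
  congr 1
  rw [Matrix.mul_assoc, Matrix.mul_assoc, trace_mul_comm]
  simp only [Matrix.mul_assoc]

/-- Z = `lyap M G` almost solves the equation of M': the error D lies between -τG and τG with τ =
‖D‖/μ ≤ 1/2. So Z is a supersolution for (1 - τ)G, which proves M' stable, and a subsolution for (1
+ τ)G; comparison traps `lyap M' G` between (1 - 2τ)Z and (1 + 2τ)Z. -/
theorem SqSummable.perturb (h : SqSummable M) {μ : ℝ} (hμ : 0 < μ) (hG : μ • 1 ≤ G)
    (hδ : ‖M' * lyap M G * M'ᵀ - M * lyap M G * Mᵀ‖ ≤ μ / 2) :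
    SqSummable M' ∧ ‖lyap M' G - lyap M G‖ ≤
      6 * (‖M' * lyap M G * M'ᵀ - M * lyap M G * Mᵀ‖ / μ) * ‖lyap M G‖ := by
  have hG0 : 0 ≤ G := (smul_nonneg_of_nonneg hμ.le one_nonneg').trans hG
  have hZ := h.lyap_eq G
  have hZ0 := h.lyap_nonneg hG0
  set Z := lyap M G with hZdef
  set D := M' * Z * M'ᵀ - M * Z * Mᵀ with hD
  set δ := ‖D‖ with hδdef
  have hδ0 : 0 ≤ δ := norm_nonneg _
  set τ := δ / μ with hτ
  have hτ0 : 0 ≤ τ := by positivity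
  have hτ2 : τ ≤ 1 / 2 := by rw [hτ, div_le_iff₀ hμ]; linarith
  have hDt : Dᵀ = D := by
    rw [hD, transpose_sub, transpose_eq_of_nonneg (conj_nonneg hZ0 M'),
      transpose_eq_of_nonneg (conj_nonneg hZ0 M)]
  have hδG : δ • 1 ≤ τ • G := by
    have := smul_le_smul_left_of_nonneg hτ0 hG
    rwa [smul_smul, hτ, div_mul_cancel₀ _ hμ.ne'] at this
  have hD1 : D ≤ τ • G := (le_norm_smul_one hDt).trans hδG
  have hD2 : -(τ • G) ≤ D := (neg_le_neg hδG).trans (neg_norm_smul_one_le hDt)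
  have hZD : Z = G + M' * Z * M'ᵀ - D := by
    rw [hD]; conv_lhs => rw [hZ]
    abel
  have hlow : (1 - τ) • G + M' * Z * M'ᵀ ≤ Z := by
    conv_rhs => rw [hZD]
    rw [sub_smul, one_smul, sub_add_eq_add_sub]
    exact sub_le_sub_left hD1 _
  have hup : Z ≤ (1 + τ) • G + M' * Z * M'ᵀ := by
    conv_lhs => rw [hZD]
    rw [add_smul, one_smul, sub_eq_add_neg, add_right_comm]
    gcongr
    exact neg_le.1 hD2
  have hS : SqSummable M' := by
    refine sqSummable_of_lyap_le (half_pos hμ) hZ0 (le_trans ?_ hlow)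
    gcongr
    calc (μ / 2) • (1 : Matrix n n ℝ) = (1 / 2 : ℝ) • μ • 1 := by rw [smul_smul]; ring_nf
      _ ≤ (1 / 2 : ℝ) • G := smul_le_smul_left_of_nonneg (by norm_num) hG
      _ ≤ (1 - τ) • G := smul_le_smul_right_of_nonneg hG0 (by linarith)
  refine ⟨hS, ?_⟩
  have h1 := hS.lyap_le hlow
  have h2 := hS.le_lyap hup
  rw [hS.lyap_smul] at h1 h2
  have hZ'0 := hS.lyap_nonneg hG0
  set Z' := lyap M' G with hZ'
  have h3 : Z' ≤ (1 + 2 * τ) • Z := by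
    calc Z' = (1 : ℝ) • Z' := (one_smul _ _).symm
      _ ≤ ((1 + 2 * τ) * (1 - τ)) • Z' := smul_le_smul_right_of_nonneg hZ'0 (by nlinarith)
      _ = (1 + 2 * τ) • (1 - τ) • Z' := (smul_smul _ _ _).symm
      _ ≤ _ := smul_le_smul_left_of_nonneg (by positivity) h1
  have h4 : (1 - 2 * τ) • Z ≤ Z' := by
    calc (1 - 2 * τ) • Z ≤ (1 - 2 * τ) • (1 + τ) • Z' :=
          smul_le_smul_left_of_nonneg (by linarith) h2
      _ = ((1 - 2 * τ) * (1 + τ)) • Z' := smul_smul _ _ _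
      _ ≤ (1 : ℝ) • Z' := smul_le_smul_right_of_nonneg hZ'0 (by nlinarith)
      _ = Z' := one_smul _ _
  -- The norm is monotone only on nonnegative matrices, so the difference is first shifted to be
  -- nonnegative; the shift costs 2τ more, whence 6 = 4 + 2.
  have h5 : ‖Z' - (1 - 2 * τ) • Z‖ ≤ 4 * τ * ‖Z‖ := by
    have := norm_mono (sub_nonneg.2 h4) (W := (4 * τ) • Z) (by
      rw [sub_le_iff_le_add, ← add_smul]
      convert h3 using 2; ring)
    rwa [norm_smul, Real.norm_of_nonneg (by positivity)] at this
  have h6 : Z' - Z = (Z' - (1 - 2 * τ) • Z) - (2 * τ) • Z := by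
    rw [sub_smul, one_smul]; abel
  rw [h6]
  refine (norm_sub_le _ _).trans ?_
  rw [norm_smul, Real.norm_of_nonneg (by positivity)]
  linarith

end Lyapunov

/-! ### Closed forms of the cost, the value matrix and the state correlation -/

namespace LQR

open scoped MatrixOrder

variable {d k : ℕ} (S : LQR d k) (K : Matrix (Fin k) (Fin d) ℝ)

/-- The closed loop matrix `A - B K`. -/
def loop : Matrix (Fin d) (Fin d) ℝ := S.A - S.B * K

/-- The one step cost matrix `Q + Kᵀ R K`. -/
def stageCost : Matrix (Fin d) (Fin d) ℝ := S.Q + Kᵀ * S.R * K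

theorem state_eq (x : Fin d → ℝ) (t : ℕ) : S.state K x t = S.loop K ^ t *ᵥ x := by
  induction t with
  | zero => simp [state]
  | succ t ih =>
    rw [state, ih, pow_succ', ← mulVec_mulVec]
    conv_rhs => rw [loop, sub_mulVec, ← mulVec_mulVec, sub_eq_add_neg, ← mulVec_neg]
    rfl

theorem dotProduct_transpose_mul_mul {m n : Type*} [Fintype m] [Fintype n] (x : n → ℝ)
    (Y : Matrix m n ℝ) (Z : Matrix m m ℝ) :
    x ⬝ᵥ (Yᵀ * Z * Y) *ᵥ x = (Y *ᵥ x) ⬝ᵥ Z *ᵥ (Y *ᵥ x) := by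
  rw [← mulVec_mulVec, ← mulVec_mulVec, dotProduct_mulVec, vecMul_transpose]

theorem stage_eq (x : Fin d → ℝ) (t : ℕ) :
    S.state K x t ⬝ᵥ (S.Q *ᵥ S.state K x t) + S.control K x t ⬝ᵥ (S.R *ᵥ S.control K x t) =
      x ⬝ᵥ ((S.loop K ^ t)ᵀ * S.stageCost K * S.loop K ^ t) *ᵥ x := by
  rw [dotProduct_transpose_mul_mul, stageCost, add_mulVec, dotProduct_add,
    dotProduct_transpose_mul_mul, control, state_eq]
  simp [mulVec_neg]

variable {S K}

theorem quadratic_eq_sum {n : Type*} [Fintype n] (x : n → ℝ) (Z : Matrix n n ℝ) :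
    x ⬝ᵥ Z *ᵥ x = ∑ i, ∑ j, Z i j * (x i * x j) := by
  simp only [dotProduct, mulVec, Finset.mul_sum]
  exact Finset.sum_congr rfl fun i _ => Finset.sum_congr rfl fun j _ => by ring

theorem integrable_quadratic (hI : ∀ i j, Integrable (fun x : Fin d → ℝ => x i * x j) S.D)
    (Z : Matrix (Fin d) (Fin d) ℝ) : Integrable (fun x => x ⬝ᵥ Z *ᵥ x) S.D := by
  simp only [quadratic_eq_sum]
  exact integrable_finsetSum _ fun i _ => integrable_finsetSum _ fun j _ => (hI i j).const_mul _

theorem integral_quadratic (hI : ∀ i j, Integrable (fun x : Fin d → ℝ => x i * x j) S.D)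
    (Z : Matrix (Fin d) (Fin d) ℝ) :
    ∫ x, x ⬝ᵥ Z *ᵥ x ∂S.D = (Z * S.secondMoment).trace := by
  simp only [quadratic_eq_sum]
  rw [integral_finsetSum Finset.univ (f := fun i (x : Fin d → ℝ) => ∑ j, Z i j * (x i * x j))
    fun i _ => integrable_finsetSum _ fun j _ => (hI i j).const_mul _]
  simp only [trace, diag, mul_apply, secondMoment, of_apply]
  refine Finset.sum_congr rfl fun i _ => ?_
  rw [integral_finsetSum Finset.univ (f := fun j (x : Fin d → ℝ) => Z i j * (x i * x j))
    fun j _ => (hI i j).const_mul _]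
  refine Finset.sum_congr rfl fun j _ => ?_
  rw [integral_const_mul]
  simp only [mul_comm]

theorem secondMoment_nonneg (hI : ∀ i j, Integrable (fun x : Fin d → ℝ => x i * x j) S.D) :
    0 ≤ S.secondMoment := by
  rw [nonneg_iff_dotProduct]
  constructor
  · ext i j
    simp only [secondMoment, transpose_apply, of_apply, mul_comm]
  · intro y
    have h : ∀ x : Fin d → ℝ, (y ⬝ᵥ x) ^ 2 = x ⬝ᵥ vecMulVec y y *ᵥ x := by
      intro x
      rw [vecMulVec_mulVec]
      simp [dotProduct_comm x y, sq, dotProduct_smul]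
    have h2 : y ⬝ᵥ S.secondMoment *ᵥ y = (vecMulVec y y * S.secondMoment).trace := by
      rw [quadratic_eq_sum]
      simp only [trace, diag, mul_apply, vecMulVec_apply]
      rw [Finset.sum_comm]
      refine Finset.sum_congr rfl fun i _ => Finset.sum_congr rfl fun j _ => by ring
    rw [h2, ← integral_quadratic hI]
    refine integral_nonneg fun x => ?_
    simp only [← h]
    positivity

theorem stageCost_ge (hR : S.R.PosDef) : S.Q ≤ S.stageCost K :=
  le_add_of_nonneg_right (conj_nonneg' hR.posSemidef.nonneg K)

theorem stageCost_nonneg (hQ : S.Q.PosDef) (hR : S.R.PosDef) : 0 ≤ S.stageCost K :=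
  hQ.posSemidef.nonneg.trans (stageCost_ge hR)

/-- Finite second moments come from the finite cost: its term at t = 0 already dominates
σ_min(Q)|x₀|². -/
theorem integrable_of_cost_ne_top (hd : 0 < d) (hQ : S.Q.PosDef) (hR : S.R.PosDef)
    (h : S.cost K ≠ ∞) (i j : Fin d) : Integrable (fun x : Fin d → ℝ => x i * x j) S.D := by
  have hσ := sigmaMin_pos hd hQ
  have hQσ := sigmaMin_smul_one_le hQ.posSemidef.nonneg
  have hq : Integrable (fun x : Fin d → ℝ => x ⬝ᵥ S.stageCost K *ᵥ x) S.D := by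
    have hm : Continuous fun x : Fin d → ℝ => x ⬝ᵥ S.stageCost K *ᵥ x := by fun_prop
    rw [← lintegral_ofReal_ne_top_iff_integrable hm.aestronglyMeasurable
      (Filter.Eventually.of_forall fun x =>
        (nonneg_iff_dotProduct.1 (stageCost_nonneg hQ hR)).2 x)]
    refine ne_top_of_le_ne_top h (lintegral_mono fun x => ?_)
    refine le_trans ?_ (ENNReal.le_tsum 0)
    rw [stage_eq]
    simp
  refine (hq.const_mul (sigmaMin S.Q)⁻¹).mono' (by fun_prop) (Filter.Eventually.of_forall fun x => ?_)
  have h1 := dotProduct_le_of_le (hQσ.trans (stageCost_ge (K := K) hR)) x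
  simp only [smul_mulVec, one_mulVec, dotProduct_smul, smul_eq_mul] at h1
  rw [le_inv_mul_iff₀ hσ]
  refine le_trans (mul_le_mul_of_nonneg_left ?_ hσ.le) h1
  rw [Real.norm_eq_abs, abs_mul, dotProduct]
  have hi : x i * x i ≤ ∑ i, x i * x i :=
    Finset.single_le_sum (f := fun i => x i * x i) (fun i _ => mul_self_nonneg _) (Finset.mem_univ i)
  have hj : x j * x j ≤ ∑ i, x i * x i :=
    Finset.single_le_sum (f := fun i => x i * x i) (fun i _ => mul_self_nonneg _) (Finset.mem_univ j)
  nlinarith [sq_nonneg (|x i| - |x j|), abs_mul_abs_self (x i), abs_mul_abs_self (x j)]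

theorem trace_cycle_conj {n : Type*} [Fintype n] [DecidableEq n] (N Z G : Matrix n n ℝ) :
    (Nᵀ * Z * N * G).trace = (Z * (N * G * Nᵀ)).trace := by
  rw [Matrix.mul_assoc, Matrix.mul_assoc, trace_mul_comm]
  simp only [Matrix.mul_assoc]

theorem cost_eq_tsum (hI : ∀ i j, Integrable (fun x : Fin d → ℝ => x i * x j) S.D)
    (hQ : S.Q.PosDef) (hR : S.R.PosDef) :
    S.cost K = ∑' t : ℕ, ENNReal.ofReal
      (S.stageCost K * (S.loop K ^ t * S.secondMoment * (S.loop K ^ t)ᵀ)).trace := by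
  simp only [cost, stage_eq]
  rw [lintegral_tsum fun t => by
    have : Continuous fun x : Fin d → ℝ =>
      x ⬝ᵥ ((S.loop K ^ t)ᵀ * S.stageCost K * S.loop K ^ t) *ᵥ x := by fun_prop
    exact this.measurable.ennreal_ofReal.aemeasurable]
  refine tsum_congr fun t => ?_
  rw [← ofReal_integral_eq_lintegral_ofReal (integrable_quadratic hI _)
    (Filter.Eventually.of_forall fun x => (nonneg_iff_dotProduct.1
      (conj_nonneg' (stageCost_nonneg hQ hR) _)).2 x), integral_quadratic hI, trace_cycle_conj]

/-- Since μ > 0 the initial state excites all directions: the stage cost at time t is at least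
σ_min(Q) μ ‖Mᵗ‖². -/
theorem sqSummable_of_cost_ne_top (hI : ∀ i j, Integrable (fun x : Fin d → ℝ => x i * x j) S.D)
    (hQ : S.Q.PosDef) (hR : S.R.PosDef) (hμ : 0 < S.mu) (h : S.cost K ≠ ∞) :
    SqSummable (S.loop K) := by
  have hG := secondMoment_nonneg hI
  have hσ := sigmaMin_pos (pos_of_sigmaMin_pos hμ) hQ
  have hσQ := (sigmaMin_smul_one_le hQ.posSemidef.nonneg).trans (stageCost_ge (K := K) hR)
  have hX : ∀ t : ℕ, 0 ≤ S.loop K ^ t * S.secondMoment * (S.loop K ^ t)ᵀ :=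
    fun t => conj_nonneg hG _
  refine sqSummable_of_summable_trace hμ (sigmaMin_smul_one_le hG) ?_
  rw [cost_eq_tsum hI hQ hR] at h
  have h1 := ENNReal.summable_toReal h
  refine Summable.of_nonneg_of_le (fun t => trace_nonneg_of_nonneg (hX t)) (fun t => ?_)
    (h1.mul_left (sigmaMin S.Q)⁻¹)
  rw [ENNReal.toReal_ofReal (trace_mul_nonneg (stageCost_nonneg hQ hR) (hX t)),
    le_inv_mul_iff₀ hσ]
  have := trace_mul_mono_left hσQ (hX t)
  simpa using this

theorem hasSum_cost (hM : SqSummable (S.loop K)) (Z : Matrix (Fin d) (Fin d) ℝ) :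
    HasSum (fun t : ℕ => (Z * (S.loop K ^ t * S.secondMoment * (S.loop K ^ t)ᵀ)).trace)
      (Z * lyap (S.loop K) S.secondMoment).trace :=
  ((hM.hasSum_lyap S.secondMoment).mul_left Z).map (traceAddMonoidHom (Fin d) ℝ)
    (continuous_id.matrix_trace)

theorem cost_eq_ofReal (hI : ∀ i j, Integrable (fun x : Fin d → ℝ => x i * x j) S.D)
    (hQ : S.Q.PosDef) (hR : S.R.PosDef) (hM : SqSummable (S.loop K)) :
    S.cost K = ENNReal.ofReal (S.stageCost K * lyap (S.loop K) S.secondMoment).trace := by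
  have hs := hasSum_cost hM (S.stageCost K)
  rw [cost_eq_tsum hI hQ hR, ← hs.tsum_eq]
  exact (ENNReal.ofReal_tsum_of_nonneg (fun t => trace_mul_nonneg (stageCost_nonneg hQ hR)
    (conj_nonneg (secondMoment_nonneg hI) _)) hs.summable).symm

theorem costR_eq (hI : ∀ i j, Integrable (fun x : Fin d → ℝ => x i * x j) S.D)
    (hQ : S.Q.PosDef) (hR : S.R.PosDef) (hM : SqSummable (S.loop K)) :
    S.costR K = (S.stageCost K * lyap (S.loop K) S.secondMoment).trace := by
  rw [costR, cost_eq_ofReal hI hQ hR hM, ENNReal.toReal_ofReal]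
  exact trace_mul_nonneg (stageCost_nonneg hQ hR) (hM.lyap_nonneg (secondMoment_nonneg hI))

theorem valueMatrix_eq (hM : SqSummable (S.loop K)) :
    S.valueMatrix K = lyap (S.loop K)ᵀ (S.stageCost K) := by
  refine hM.transpose.eq_lyap ?_
  rw [transpose_transpose]
  refine Classical.epsilon_spec (p := fun P : Matrix (Fin d) (Fin d) ℝ =>
    P = S.Q + Kᵀ * S.R * K + (S.A - S.B * K)ᵀ * P * (S.A - S.B * K))
    ⟨lyap (S.loop K)ᵀ (S.stageCost K), ?_⟩
  have := hM.transpose.lyap_eq (S.stageCost K)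
  rwa [transpose_transpose] at this

theorem mulVec_mul_mulVec_eq {n : Type*} [Fintype n] [DecidableEq n] (N : Matrix n n ℝ)
    (x : n → ℝ) (i j : n) :
    (N *ᵥ x) i * (N *ᵥ x) j = x ⬝ᵥ (Nᵀ * Matrix.single i j 1 * N) *ᵥ x := by
  rw [dotProduct_transpose_mul_mul, single_mulVec]
  simp [dotProduct, Function.update_apply]

theorem trace_single_mul {n : Type*} [Fintype n] [DecidableEq n] (i j : n) (Z : Matrix n n ℝ) :
    (Matrix.single i j 1 * Z).trace = Z j i := by
  simp [Matrix.trace_single_mul]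

/-- Sum and integral are exchanged by dominating |yᵢyⱼ| by |y|², whose integrals are summable.
Entries are written as quadratic forms in x₀ so that the trace formulas apply. -/
theorem stateCorr_eq (hI : ∀ i j, Integrable (fun x : Fin d → ℝ => x i * x j) S.D)
    (hM : SqSummable (S.loop K)) : S.stateCorr K = lyap (S.loop K) S.secondMoment := by
  have hG := secondMoment_nonneg hI
  ext i j
  simp only [stateCorr, of_apply, state_eq, mulVec_mul_mulVec_eq]
  rw [← integral_tsum_of_summable_integral_norm (fun t => integrable_quadratic hI _)]
  · simp only [integral_quadratic hI, trace_cycle_conj]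
    rw [(hasSum_cost hM _).tsum_eq, trace_single_mul]
    rw [← transpose_apply (lyap _ _), transpose_eq_of_nonneg (hM.lyap_nonneg hG)]
  · have h1 := (hasSum_cost hM 1).summable
    refine Summable.of_nonneg_of_le (fun t => integral_nonneg fun x => norm_nonneg _)
      (fun t => ?_) h1
    rw [← trace_cycle_conj, ← integral_quadratic hI]
    refine integral_mono (integrable_quadratic hI _).norm (integrable_quadratic hI _) fun x => ?_
    simp only [dotProduct_transpose_mul_mul, one_mulVec]
    rw [single_mulVec]
    set y := S.loop K ^ t *ᵥ x
    rw [Real.norm_eq_abs]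
    simp only [dotProduct, one_mul, Function.update_apply, Pi.zero_apply, mul_ite, mul_zero,
      Finset.sum_ite_eq', Finset.mem_univ, if_true, abs_mul]
    have hi : y i * y i ≤ ∑ i, y i * y i := Finset.single_le_sum (f := fun i => y i * y i)
      (fun i _ => mul_self_nonneg _) (Finset.mem_univ i)
    have hj : y j * y j ≤ ∑ i, y i * y i := Finset.single_le_sum (f := fun i => y i * y i)
      (fun i _ => mul_self_nonneg _) (Finset.mem_univ j)
    nlinarith [sq_nonneg (|y i| - |y j|), abs_mul_abs_self (y i), abs_mul_abs_self (y j)]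

end LQR

/-! ### Bellman defect, gradient domination, gradient formula and one-step descent -/

namespace LQR

open scoped MatrixOrder

variable {d k : ℕ}

/-- Positive definite cost matrices and a finite nondegenerate second moment of the initial
state. -/
structure Regular (S : LQR d k) : Prop where
  Q_posDef : S.Q.PosDef
  R_posDef : S.R.PosDef
  integrable : ∀ i j, Integrable (fun x : Fin d → ℝ => x i * x j) S.D
  mu_pos : 0 < S.mu

/-- `K` stabilizes the system. -/
def Stabilizing (S : LQR d k) (K : Matrix (Fin k) (Fin d) ℝ) : Prop := SqSummable (S.loop K)

/-- The matrix `R + Bᵀ P_K B`. -/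
noncomputable def inputHess (S : LQR d k) (K : Matrix (Fin k) (Fin d) ℝ) : Matrix (Fin k) (Fin k) ℝ :=
  S.R + S.Bᵀ * S.valueMatrix K * S.B

/-- The matrix `E_K = (R + Bᵀ P_K B) K - Bᵀ P_K A`, for which `∇C(K) = 2 E_K Σ_K`. -/
noncomputable def gradFactor (S : LQR d k) (K : Matrix (Fin k) (Fin d) ℝ) : Matrix (Fin k) (Fin d) ℝ :=
  S.inputHess K * K - S.Bᵀ * S.valueMatrix K * S.A

/-- The defect `Q + K'ᵀ R K' + (A - B K')ᵀ P_K (A - B K') - P_K`. -/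
noncomputable def bellmanDefect (S : LQR d k) (K K' : Matrix (Fin k) (Fin d) ℝ) : Matrix (Fin d) (Fin d) ℝ :=
  S.stageCost K' + (S.loop K')ᵀ * S.valueMatrix K * S.loop K' - S.valueMatrix K

variable {S : LQR d k} {K K' : Matrix (Fin k) (Fin d) ℝ}

theorem Regular.secondMoment_nonneg (h : S.Regular) : 0 ≤ S.secondMoment :=
  LQR.secondMoment_nonneg h.integrable

theorem Regular.dim_pos (h : S.Regular) : 0 < d := pos_of_sigmaMin_pos h.mu_pos

theorem Regular.mu_smul_one_le (h : S.Regular) : S.mu • 1 ≤ S.secondMoment :=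
  sigmaMin_smul_one_le h.secondMoment_nonneg

theorem Regular.sigmaMin_Q_pos (h : S.Regular) : 0 < sigmaMin S.Q :=
  sigmaMin_pos h.dim_pos h.Q_posDef

theorem Regular.R_nonneg (h : S.Regular) : 0 ≤ S.R := h.R_posDef.posSemidef.nonneg

theorem Regular.stageCost_nonneg (h : S.Regular) (K : Matrix (Fin k) (Fin d) ℝ) :
    0 ≤ S.stageCost K := LQR.stageCost_nonneg h.Q_posDef h.R_posDef

theorem Regular.sigmaMin_Q_smul_one_le (h : S.Regular) (K : Matrix (Fin k) (Fin d) ℝ) :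
    sigmaMin S.Q • 1 ≤ S.stageCost K :=
  (sigmaMin_smul_one_le h.Q_posDef.posSemidef.nonneg).trans (stageCost_ge h.R_posDef)

theorem Regular.stabilizing_iff (h : S.Regular) : S.Stabilizing K ↔ S.cost K ≠ ∞ := by
  refine ⟨fun hK => ?_, sqSummable_of_cost_ne_top h.integrable h.Q_posDef h.R_posDef h.mu_pos⟩
  rw [cost_eq_ofReal h.integrable h.Q_posDef h.R_posDef hK]
  exact ENNReal.ofReal_ne_top

theorem Regular.stateCorr_eq (h : S.Regular) (hK : S.Stabilizing K) :
    S.stateCorr K = lyap (S.loop K) S.secondMoment := LQR.stateCorr_eq h.integrable hK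

theorem Regular.mu_smul_one_le_stateCorr (h : S.Regular) (hK : S.Stabilizing K) :
    S.mu • 1 ≤ S.stateCorr K := by
  rw [h.stateCorr_eq hK]
  exact h.mu_smul_one_le.trans (SqSummable.le_lyap_self hK h.secondMoment_nonneg)

theorem Regular.stateCorr_nonneg (h : S.Regular) (hK : S.Stabilizing K) : 0 ≤ S.stateCorr K :=
  (smul_nonneg_of_nonneg h.mu_pos.le one_nonneg').trans (h.mu_smul_one_le_stateCorr hK)

theorem Regular.mu_le_norm_stateCorr (h : S.Regular) (hK : S.Stabilizing K) :
    S.mu ≤ ‖S.stateCorr K‖ := by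
  have : Nonempty (Fin d) := ⟨⟨0, h.dim_pos⟩⟩
  have h1 := norm_mono (smul_nonneg_of_nonneg h.mu_pos.le one_nonneg')
    (h.mu_smul_one_le_stateCorr hK)
  rwa [norm_smul, CStarRing.norm_one, mul_one, Real.norm_of_nonneg h.mu_pos.le] at h1

theorem Stabilizing.valueMatrix_eq (hK : S.Stabilizing K) :
    S.valueMatrix K = lyap (S.loop K)ᵀ (S.stageCost K) := LQR.valueMatrix_eq hK

theorem Stabilizing.valueMatrix_bellman (hK : S.Stabilizing K) :
    S.valueMatrix K = S.stageCost K + (S.loop K)ᵀ * S.valueMatrix K * S.loop K := by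
  rw [hK.valueMatrix_eq]
  have := (SqSummable.transpose hK).lyap_eq (S.stageCost K)
  rwa [transpose_transpose] at this

theorem Regular.stageCost_le_valueMatrix (h : S.Regular) (hK : S.Stabilizing K) :
    S.stageCost K ≤ S.valueMatrix K := by
  rw [hK.valueMatrix_eq]
  exact (SqSummable.transpose hK).le_lyap_self (h.stageCost_nonneg K)

theorem Regular.valueMatrix_nonneg (h : S.Regular) (hK : S.Stabilizing K) :
    0 ≤ S.valueMatrix K :=
  (h.stageCost_nonneg K).trans (h.stageCost_le_valueMatrix hK)

theorem Regular.costR_eq_trace_stateCorr (h : S.Regular) (hK : S.Stabilizing K) :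
    S.costR K = (S.stageCost K * S.stateCorr K).trace := by
  rw [costR_eq h.integrable h.Q_posDef h.R_posDef hK, h.stateCorr_eq hK]

theorem Regular.costR_eq_trace_valueMatrix (h : S.Regular) (hK : S.Stabilizing K) :
    S.costR K = (S.valueMatrix K * S.secondMoment).trace := by
  rw [costR_eq h.integrable h.Q_posDef h.R_posDef hK, hK.valueMatrix_eq]
  exact SqSummable.trace_mul_lyap hK _ _

/-- Put G = Σ' - M'Σ'M'ᵀ, the Lyapunov equation of K', into C(K) = tr(P G) and move M' onto P by
cyclicity. -/
theorem Regular.costR_sub (h : S.Regular) (hK : S.Stabilizing K) (hK' : S.Stabilizing K') :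
    S.costR K' - S.costR K = (S.bellmanDefect K K' * S.stateCorr K').trace := by
  rw [h.costR_eq_trace_stateCorr hK', h.costR_eq_trace_valueMatrix hK]
  have hZ := SqSummable.lyap_eq hK' S.secondMoment
  rw [← h.stateCorr_eq hK'] at hZ
  set Z := S.stateCorr K'
  have hG : S.secondMoment = Z - S.loop K' * Z * (S.loop K')ᵀ := by
    rw [eq_sub_iff_add_eq]; exact hZ.symm
  rw [hG, bellmanDefect, Matrix.sub_mul, Matrix.add_mul, Matrix.mul_sub, trace_sub, trace_sub,
    trace_add, trace_cycle_conj]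
  ring

theorem Regular.inputHess_nonneg (h : S.Regular) (hK : S.Stabilizing K) : 0 ≤ S.inputHess K :=
  add_nonneg h.R_nonneg (conj_nonneg' (h.valueMatrix_nonneg hK) _)

theorem Regular.R_le_inputHess (h : S.Regular) (hK : S.Stabilizing K) : S.R ≤ S.inputHess K :=
  le_add_of_nonneg_right (conj_nonneg' (h.valueMatrix_nonneg hK) _)

theorem Regular.inputHess_posDef (h : S.Regular) (hK : S.Stabilizing K) :
    (S.inputHess K).PosDef :=
  h.R_posDef.add_posSemidef (conj_nonneg' (h.valueMatrix_nonneg hK) _).posSemidef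

theorem Regular.bellmanDefect_eq (h : S.Regular) (hK : S.Stabilizing K)
    (K' : Matrix (Fin k) (Fin d) ℝ) :
    S.bellmanDefect K K' = (K' - K)ᵀ * S.gradFactor K + (S.gradFactor K)ᵀ * (K' - K) +
      (K' - K)ᵀ * S.inputHess K * (K' - K) := by
  have hP := hK.valueMatrix_bellman
  have hPt := transpose_eq_of_nonneg (h.valueMatrix_nonneg hK)
  have hRt := transpose_eq_of_nonneg h.R_nonneg
  obtain ⟨Δ, rfl⟩ : ∃ Δ, K' = K + Δ := ⟨K' - K, by abel⟩
  rw [add_sub_cancel_left, bellmanDefect]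
  -- Only the subtracted P is expanded by its Bellman equation; this cancels the terms of order zero
  -- in Δ.
  nth_rw 2 [hP]
  simp only [stageCost, loop, gradFactor, inputHess, transpose_sub, transpose_add, transpose_mul,
    Matrix.mul_add, Matrix.add_mul, Matrix.mul_sub, Matrix.sub_mul, hPt, hRt, transpose_transpose,
    Matrix.mul_assoc]
  abel

/-- Completing the square, V + Eᵀρ⁻¹E = (Δ + ρ⁻¹E)ᵀρ(Δ + ρ⁻¹E) ≥ 0; pair this with Σ_{K'} ≤
‖Σ_{K'}‖. The next lemma does the same after weakening ρ to σ_min(R). -/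
theorem Regular.gradient_domination_inv (h : S.Regular) (hK : S.Stabilizing K)
    (hK' : S.Stabilizing K') :
    S.costR K - S.costR K' ≤ ‖S.stateCorr K'‖ *
      ((S.gradFactor K)ᵀ * (S.inputHess K)⁻¹ * S.gradFactor K).trace := by
  have hu := (h.inputHess_posDef hK).isUnit
  have hdet := (isUnit_iff_isUnit_det _).1 hu
  have hρt := transpose_eq_of_nonneg (h.inputHess_nonneg hK)
  have hρ := h.inputHess_nonneg hK
  have hsub := h.costR_sub hK hK'
  rw [h.bellmanDefect_eq hK] at hsub
  set E := S.gradFactor K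
  set ρ := S.inputHess K
  set Δ := K' - K
  have hit : ρ⁻¹ᵀ = ρ⁻¹ := by rw [transpose_nonsing_inv, hρt]
  have hsq : Δᵀ * E + Eᵀ * Δ + Δᵀ * ρ * Δ + Eᵀ * ρ⁻¹ * E =
      (Δ + ρ⁻¹ * E)ᵀ * ρ * (Δ + ρ⁻¹ * E) := by
    simp only [transpose_add, transpose_mul, hit, Matrix.mul_add, Matrix.add_mul,
      Matrix.mul_assoc, mul_nonsing_inv_cancel_left _ _ hdet, nonsing_inv_mul_cancel_left _ _ hdet]
    abel
  have hZ := h.stateCorr_nonneg hK'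
  have h1 := trace_mul_nonneg (conj_nonneg' hρ (Δ + ρ⁻¹ * E)) hZ
  rw [← hsq, Matrix.add_mul _ (Eᵀ * ρ⁻¹ * E), trace_add, ← hsub] at h1
  have h2 := trace_mul_mono_right (le_norm_smul_one (transpose_eq_of_nonneg hZ))
    (conj_nonneg' (PosSemidef.inv hρ.posSemidef).nonneg E)
  simp only [Matrix.mul_smul, Matrix.mul_one, trace_smul, smul_eq_mul] at h2
  linarith

theorem Regular.gradient_domination (h : S.Regular) (hk : 0 < k) (hK : S.Stabilizing K)
    (hK' : S.Stabilizing K') :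
    S.costR K - S.costR K' ≤ ‖S.stateCorr K'‖ *
      ((sigmaMin S.R)⁻¹ * ((S.gradFactor K)ᵀ * S.gradFactor K).trace) := by
  have hσ := sigmaMin_pos hk h.R_posDef
  have hρ := (sigmaMin_smul_one_le h.R_nonneg).trans (h.R_le_inputHess hK)
  have hsub := h.costR_sub hK hK'
  rw [h.bellmanDefect_eq hK] at hsub
  set E := S.gradFactor K
  set ρ := S.inputHess K
  set Δ := K' - K
  set σ := sigmaMin S.R
  have hsq : Δᵀ * E + Eᵀ * Δ + Δᵀ * (σ • (1 : Matrix (Fin k) (Fin k) ℝ)) * Δ + σ⁻¹ • (Eᵀ * E) =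
      σ • ((Δ + σ⁻¹ • E)ᵀ * (Δ + σ⁻¹ • E)) := by
    simp only [transpose_add, transpose_smul, Matrix.mul_add, Matrix.add_mul, Matrix.mul_smul,
      Matrix.smul_mul, Matrix.mul_one, smul_add, smul_smul]
    rw [← mul_assoc, mul_inv_cancel₀ hσ.ne', one_mul, one_smul, one_smul]
    abel
  have hZ := h.stateCorr_nonneg hK'
  have h0 : 0 ≤ Δᵀ * E + Eᵀ * Δ + Δᵀ * ρ * Δ + σ⁻¹ • (Eᵀ * E) := by
    refine le_trans ?_ (add_le_add_left (add_le_add_right (conj_mono' hρ Δ) _) _)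
    rw [hsq]
    exact smul_nonneg_of_nonneg hσ.le (transpose_mul_self_nonneg _)
  have h1 := trace_mul_nonneg h0 hZ
  rw [Matrix.add_mul _ (σ⁻¹ • (Eᵀ * E)), trace_add, ← hsub] at h1
  have h2 := trace_mul_mono_right (le_norm_smul_one (transpose_eq_of_nonneg hZ))
    (smul_nonneg_of_nonneg (inv_nonneg.2 hσ.le) (transpose_mul_self_nonneg E))
  simp only [Matrix.mul_smul, Matrix.mul_one, trace_smul, smul_eq_mul] at h2
  linarith

/-- A nonpositive defect says that P is a Lyapunov supersolution for the transposed loop of K', so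
stability is obtained before any cost is compared. The decrease then follows from Σ_{K'} ≥ μ. -/
theorem Regular.descent (h : S.Regular) (hK : S.Stabilizing K) {W : Matrix (Fin d) (Fin d) ℝ}
    (hW : 0 ≤ W) (hV : S.bellmanDefect K K' ≤ -W) :
    S.Stabilizing K' ∧ S.costR K' ≤ S.costR K - S.mu * W.trace := by
  have hV0 : S.bellmanDefect K K' ≤ 0 := hV.trans (neg_nonpos.2 hW)
  have hK' : S.Stabilizing K' := by
    have h1 : sigmaMin S.Q • 1 + (S.loop K')ᵀ * S.valueMatrix K * (S.loop K')ᵀᵀ ≤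
        S.valueMatrix K := by
      rw [transpose_transpose]
      exact (add_le_add_left (h.sigmaMin_Q_smul_one_le K') _).trans (sub_nonpos.1 hV0)
    have h2 := (sqSummable_of_lyap_le h.sigmaMin_Q_pos (h.valueMatrix_nonneg hK) h1).transpose
    rwa [transpose_transpose] at h2
  refine ⟨hK', ?_⟩
  have h1 := h.costR_sub hK hK'
  have h2 := trace_mul_mono_left hV (h.stateCorr_nonneg hK')
  have h3 := trace_mul_mono_right (h.mu_smul_one_le_stateCorr hK') hW
  simp only [Matrix.neg_mul, trace_neg, Matrix.mul_smul, Matrix.mul_one, trace_smul,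
    smul_eq_mul] at h2 h3
  linarith

theorem trace_defect {ι κ : Type*} [Fintype ι] [Fintype κ]
    (Δ E : Matrix κ ι ℝ) (ρ : Matrix κ κ ℝ) {Z : Matrix ι ι ℝ} (hZ : Zᵀ = Z) :
    ((Δᵀ * E + Eᵀ * Δ + Δᵀ * ρ * Δ) * Z).trace =
      2 * (Δᵀ * E * Z).trace + (Δᵀ * ρ * Δ * Z).trace := by
  have : (Eᵀ * Δ * Z).trace = (Δᵀ * E * Z).trace := by
    rw [← trace_transpose, transpose_mul, transpose_mul, transpose_transpose, hZ,
      trace_mul_comm]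
  rw [Matrix.add_mul, Matrix.add_mul, trace_add, trace_add, this]
  ring

open Filter Topology in
-- The difference quotient is explicit by `Regular.costR_sub`, with Σ taken at K + sH. Continuity of
-- Σ, from `SqSummable.perturb`, suffices; Σ is never differentiated.
theorem Regular.hasDerivAt_costR (h : S.Regular) (hK : S.Stabilizing K)
    (H : Matrix (Fin k) (Fin d) ℝ) :
    HasDerivAt (fun s : ℝ => S.costR (K + s • H))
      (2 * (Hᵀ * S.gradFactor K * S.stateCorr K).trace) 0 := by
  set Z := lyap (S.loop K) S.secondMoment with hZ
  set F : ℝ → Matrix (Fin d) (Fin d) ℝ := fun s =>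
    S.loop (K + s • H) * Z * (S.loop (K + s • H))ᵀ - S.loop K * Z * (S.loop K)ᵀ with hF
  have hF0 : Tendsto (fun s => ‖F s‖) (𝓝 0) (𝓝 0) := by
    have hc : Continuous fun s => ‖F s‖ := by
      simp only [hF, loop]; fun_prop
    simpa [hF] using hc.tendsto 0
  have hev : ∀ᶠ s in 𝓝 (0 : ℝ), ‖F s‖ ≤ S.mu / 2 :=
    hF0.eventually (eventually_le_nhds (half_pos h.mu_pos))
  have hstab : ∀ᶠ s in 𝓝 (0 : ℝ), S.Stabilizing (K + s • H) :=
    hev.mono fun s hs => (SqSummable.perturb hK h.mu_pos h.mu_smul_one_le hs).1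
  have hZlim : Tendsto (fun s : ℝ => S.stateCorr (K + s • H)) (𝓝 0) (𝓝 (S.stateCorr K)) := by
    rw [tendsto_iff_norm_sub_tendsto_zero]
    have hlim : Tendsto (fun s => 6 * (‖F s‖ / S.mu) * ‖Z‖) (𝓝 0) (𝓝 0) := by
      simpa using ((hF0.div_const S.mu).const_mul 6).mul_const ‖Z‖
    refine squeeze_zero' (Eventually.of_forall fun s => norm_nonneg _) ?_ hlim
    filter_upwards [hev, hstab] with s hs hs'
    rw [h.stateCorr_eq hs', h.stateCorr_eq hK]
    exact (SqSummable.perturb hK h.mu_pos h.mu_smul_one_le hs).2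
  rw [hasDerivAt_iff_tendsto_slope_zero]
  have hlim : Tendsto (fun s : ℝ => 2 * (Hᵀ * S.gradFactor K * S.stateCorr (K + s • H)).trace +
      s * (Hᵀ * S.inputHess K * H * S.stateCorr (K + s • H)).trace) (𝓝 0)
      (𝓝 (2 * (Hᵀ * S.gradFactor K * S.stateCorr K).trace)) := by
    have htr : ∀ N : Matrix (Fin d) (Fin d) ℝ, Tendsto
        (fun s : ℝ => (N * S.stateCorr (K + s • H)).trace) (𝓝 0) (𝓝 (N * S.stateCorr K).trace) := fun N =>
      ((Continuous.matrix_trace (by fun_prop : Continuous fun Y : Matrix (Fin d) (Fin d) ℝ =>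
        N * Y)).tendsto _).comp hZlim
    have hid : Tendsto (fun s : ℝ => s) (𝓝 0) (𝓝 0) := tendsto_id
    have hadd := ((htr (Hᵀ * S.gradFactor K)).const_mul 2).add
      (hid.mul (htr (Hᵀ * S.inputHess K * H)))
    simpa using hadd
  refine (hlim.mono_left nhdsWithin_le_nhds).congr' ?_
  filter_upwards [nhdsWithin_le_nhds hstab, self_mem_nhdsWithin] with s hs hs0
  have hs0 : s ≠ 0 := hs0
  simp only [zero_add, zero_smul, add_zero]
  rw [h.costR_sub hK hs, h.bellmanDefect_eq hK, add_sub_cancel_left,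
    trace_defect _ _ _ (transpose_eq_of_nonneg (h.stateCorr_nonneg hs))]
  simp only [transpose_smul, Matrix.smul_mul, Matrix.mul_smul, trace_smul, smul_eq_mul]
  field_simp

theorem Regular.grad_eq (h : S.Regular) (hK : S.Stabilizing K) :
    S.grad K = (2 : ℝ) • (S.gradFactor K * S.stateCorr K) := by
  ext i j
  rw [grad, of_apply, (h.hasDerivAt_costR hK _).deriv]
  rw [Matrix.mul_assoc, transpose_single]
  simp [Matrix.trace_single_mul]

theorem Regular.isUnit_det_stateCorr (h : S.Regular) (hK : S.Stabilizing K) :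
    IsUnit (S.stateCorr K).det := by
  rw [← isUnit_iff_isUnit_det]
  have h1 : (S.mu • (1 : Matrix (Fin d) (Fin d) ℝ)).PosDef := PosDef.one.smul h.mu_pos
  have h2 := h1.add_posSemidef (h.mu_smul_one_le_stateCorr hK)
  rw [add_sub_cancel] at h2
  exact h2.isUnit

theorem Regular.half_grad_mul_inv (h : S.Regular) (hK : S.Stabilizing K) :
    ((1 / 2 : ℝ) • S.grad K) * (S.stateCorr K)⁻¹ = S.gradFactor K := by
  rw [h.grad_eq hK, smul_smul]
  norm_num
  rw [mul_nonsing_inv_cancel_right _ _ (h.isUnit_det_stateCorr hK)]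

/-- The step Δ = -ρ⁻¹E annihilates the completed square, so V = -Eᵀρ⁻¹E exactly. -/
theorem Regular.gnStep_descent (h : S.Regular) (hK : S.Stabilizing K) :
    S.Stabilizing (S.gnStep 1 K) ∧ S.costR (S.gnStep 1 K) ≤ S.costR K -
      S.mu * ((S.gradFactor K)ᵀ * (S.inputHess K)⁻¹ * S.gradFactor K).trace := by
  have hdet := (isUnit_iff_isUnit_det _).1 (h.inputHess_posDef hK).isUnit
  have hρt := transpose_eq_of_nonneg (h.inputHess_nonneg hK)
  refine h.descent hK (conj_nonneg' (PosSemidef.inv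
    (h.inputHess_nonneg hK).posSemidef).nonneg _) (le_of_eq ?_)
  have hstep : S.gnStep 1 K - K = -((S.inputHess K)⁻¹ * S.gradFactor K) := by
    rw [gnStep, Matrix.mul_assoc, h.half_grad_mul_inv hK, one_smul, inputHess]
    abel
  rw [h.bellmanDefect_eq hK, hstep]
  set E := S.gradFactor K
  set ρ := S.inputHess K
  have hit : ρ⁻¹ᵀ = ρ⁻¹ := by rw [transpose_nonsing_inv, hρt]
  simp only [transpose_neg, transpose_mul, hit, Matrix.mul_neg, Matrix.neg_mul, neg_neg,
    Matrix.mul_assoc, mul_nonsing_inv_cancel_left _ _ hdet]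
  abel

/-- With Δ = -ηE, V = -2ηEᵀE + η²EᵀρE, and ηρ ≤ 1 lets the quadratic term consume at most half of
the linear one. -/
theorem Regular.npgStep_descent (h : S.Regular) (hK : S.Stabilizing K) {η : ℝ} (hη : 0 ≤ η)
    (hηρ : η * ‖S.inputHess K‖ ≤ 1) :
    S.Stabilizing (S.npgStep η K) ∧ S.costR (S.npgStep η K) ≤ S.costR K -
      S.mu * (η * ((S.gradFactor K)ᵀ * S.gradFactor K).trace) := by
  have hρt := transpose_eq_of_nonneg (h.inputHess_nonneg hK)
  have hstep : S.npgStep η K - K = -(η • S.gradFactor K) := by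
    rw [npgStep, h.half_grad_mul_inv hK]; abel
  have hW := smul_nonneg_of_nonneg hη (transpose_mul_self_nonneg (S.gradFactor K))
  have hV : S.bellmanDefect K (S.npgStep η K) ≤
      -(η • ((S.gradFactor K)ᵀ * S.gradFactor K)) := by
    rw [h.bellmanDefect_eq hK, hstep]
    have h1 : η • S.inputHess K ≤ 1 := by
      calc η • S.inputHess K ≤ η • ‖S.inputHess K‖ • 1 :=
            smul_le_smul_left_of_nonneg hη (le_norm_smul_one hρt)
        _ = (η * ‖S.inputHess K‖) • 1 := smul_smul _ _ _
        _ ≤ (1 : ℝ) • 1 := smul_le_smul_right_of_nonneg one_nonneg' hηρ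
        _ = 1 := one_smul _ _
    set E := S.gradFactor K
    have h2 := smul_le_smul_left_of_nonneg hη (conj_mono' h1 E)
    rw [Matrix.mul_one] at h2
    have h3 : (-(η • E))ᵀ * E + Eᵀ * -(η • E) + (-(η • E))ᵀ * S.inputHess K * -(η • E) =
        -(η • (Eᵀ * E)) - η • (Eᵀ * E) + η • (Eᵀ * (η • S.inputHess K) * E) := by
      simp only [transpose_neg, transpose_smul, Matrix.neg_mul, Matrix.mul_neg, Matrix.smul_mul,
        Matrix.mul_smul, smul_neg, neg_neg]
      abel
    rw [h3]
    calc _ ≤ -(η • (Eᵀ * E)) - η • (Eᵀ * E) + η • (Eᵀ * E) := by gcongr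
      _ = _ := sub_add_cancel _ _
  have := h.descent hK hW hV
  rwa [trace_smul, smul_eq_mul] at this

theorem mu_sq_smul_one_le_sq {n : Type*} [Fintype n] [DecidableEq n] {Z : Matrix n n ℝ} {c : ℝ}
    (hc : 0 ≤ c) (h : c • 1 ≤ Z) : c ^ 2 • 1 ≤ Z * Z := by
  have h0 := sub_nonneg.2 h
  have h1 := transpose_mul_self_nonneg (Z - c • 1)
  rw [transpose_eq_of_nonneg h0] at h1
  have h2 := add_nonneg h1 (smul_nonneg_of_nonneg (a := 2 * c) (by positivity) h0)
  rw [← sub_nonneg]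
  convert h2 using 1
  simp only [Matrix.sub_mul, Matrix.mul_sub, smul_sub, Matrix.smul_mul, Matrix.mul_smul,
    Matrix.one_mul, Matrix.mul_one, smul_smul]
  module

/-- With F = EΣ, f = tr(FᵀF) and Σ' = Σ + W, the cost changes by -4η(f + tr(FᵀEW)) + 4η² tr(FᵀρFΣ').
The hypotheses make the cross term at least -f/4 and η times the quadratic trace at most f/4,
leaving at most -2ηf ≤ -2ημ² tr(EᵀE). -/
theorem Regular.gdStep_descent (h : S.Regular) (hK : S.Stabilizing K) {η : ℝ} (hη : 0 ≤ η)
    (hδ : 24 * ‖S.loop (S.gdStep η K) * S.stateCorr K * (S.loop (S.gdStep η K))ᵀ -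
      S.loop K * S.stateCorr K * (S.loop K)ᵀ‖ * ‖S.stateCorr K‖ ≤ S.mu ^ 2)
    (hηρ : 8 * η * ‖S.inputHess K‖ * ‖S.stateCorr K‖ ≤ 1) :
    S.Stabilizing (S.gdStep η K) ∧ S.costR (S.gdStep η K) ≤ S.costR K -
      2 * η * S.mu ^ 2 * ((S.gradFactor K)ᵀ * S.gradFactor K).trace := by
  have hμ := h.mu_pos
  have hμZ := h.mu_le_norm_stateCorr hK
  set δ := ‖S.loop (S.gdStep η K) * S.stateCorr K * (S.loop (S.gdStep η K))ᵀ -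
      S.loop K * S.stateCorr K * (S.loop K)ᵀ‖ with hδdef
  have hδ0 : 0 ≤ δ := norm_nonneg _
  have hδ2 : δ ≤ S.mu / 2 := by
    have : 24 * δ * S.mu ≤ S.mu ^ 2 := le_trans (by gcongr) hδ
    nlinarith
  have hpert := SqSummable.perturb (M' := S.loop (S.gdStep η K)) hK hμ h.mu_smul_one_le
    (by rw [← h.stateCorr_eq hK]; exact hδ2)
  have hK' : S.Stabilizing (S.gdStep η K) := hpert.1
  have hW := hpert.2
  rw [← h.stateCorr_eq hK, ← h.stateCorr_eq hK', ← hδdef] at hW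
  refine ⟨hK', ?_⟩
  have hstep : S.gdStep η K - K = -((2 * η) • (S.gradFactor K * S.stateCorr K)) := by
    rw [gdStep, h.grad_eq hK, smul_smul, mul_comm]; abel
  have hsub := h.costR_sub hK hK'
  have hZ' := h.stateCorr_nonneg hK'
  have hZ'norm := le_norm_smul_one (transpose_eq_of_nonneg hZ')
  rw [h.bellmanDefect_eq hK, hstep, trace_defect _ _ _ (transpose_eq_of_nonneg hZ')] at hsub
  have hZ := h.stateCorr_nonneg hK
  have hZt := transpose_eq_of_nonneg hZ
  have hZ't := transpose_eq_of_nonneg hZ'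
  have hρ := h.inputHess_nonneg hK
  have hρnorm := le_norm_smul_one (transpose_eq_of_nonneg hρ)
  have hZμ := mu_sq_smul_one_le_sq hμ.le (h.mu_smul_one_le_stateCorr hK)
  set Z := S.stateCorr K
  set Z' := S.stateCorr (S.gdStep η K)
  set E := S.gradFactor K
  set ρ := S.inputHess K
  obtain ⟨W, hWdef⟩ : ∃ W, W = Z' - Z := ⟨_, rfl⟩
  rw [← hWdef] at hW
  have hWt : Wᵀ = W := by rw [hWdef, transpose_sub, hZt, hZ't]
  -- Origin of 24: the factor 6 of the perturbation bound times the 4 wanted here.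
  have hW4 : ‖W‖ ≤ S.mu / 4 := by
    refine hW.trans ?_
    rw [show 6 * (δ / S.mu) * ‖Z‖ = (24 * δ * ‖Z‖) / (4 * S.mu) by field_simp; ring,
      div_le_iff₀ (by positivity)]
    nlinarith
  have hZ'2 : ‖Z'‖ ≤ 2 * ‖Z‖ := by
    have : Z' = Z + W := by rw [hWdef]; abel
    rw [this]
    refine (norm_add_le _ _).trans ?_
    linarith
  set F := E * Z with hF
  set e := (Eᵀ * E).trace with he
  set f := (Fᵀ * F).trace with hf
  have he0 : 0 ≤ e := trace_nonneg_of_nonneg (transpose_mul_self_nonneg E)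
  have hf0 : 0 ≤ f := trace_nonneg_of_nonneg (transpose_mul_self_nonneg F)
  have htr : ∀ Y : Matrix (Fin d) (Fin d) ℝ, Yᵀ = Y →
      ((E * Y)ᵀ * (E * Y)).trace = (Eᵀ * E * (Y * Y)).trace := by
    intro Y hY
    rw [transpose_mul, hY, Matrix.mul_assoc, trace_mul_comm]
    simp only [Matrix.mul_assoc]
  have hef : S.mu ^ 2 * e ≤ f := by
    rw [hf, hF, htr Z hZt]
    have := trace_mul_mono_right hZμ (transpose_mul_self_nonneg E)
    simpa using this
  have hWe : ((E * W)ᵀ * (E * W)).trace ≤ f / 16 := by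
    rw [htr W hWt]
    have h1 : W * W ≤ ‖W‖ ^ 2 • 1 := by
      have := le_norm_smul_one (Z := Wᵀ * W) (by simp)
      rwa [l2_opNorm_transpose_mul_self, hWt] at this
    have h2 := trace_mul_mono_right h1 (transpose_mul_self_nonneg E)
    simp only [Matrix.mul_smul, Matrix.mul_one, trace_smul, smul_eq_mul] at h2
    have h3 : ‖W‖ ^ 2 * e ≤ (S.mu / 4) ^ 2 * e := by gcongr
    linarith
  -- Young's inequality, by expanding the square of F + 4EW; the weight 4 balances `hWe`.
  have hcross : -(f / 4) ≤ (Fᵀ * (E * W)).trace := by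
    have h1 := trace_nonneg_of_nonneg (transpose_mul_self_nonneg (F + (4 : ℝ) • (E * W)))
    have h2 : ((E * W)ᵀ * F).trace = (Fᵀ * (E * W)).trace := by
      rw [← trace_transpose, transpose_mul, transpose_transpose]
    simp only [transpose_add, transpose_smul, Matrix.mul_add, Matrix.add_mul, Matrix.mul_smul,
      Matrix.smul_mul, trace_add, trace_smul, smul_eq_mul, h2] at h1
    linarith
  have hlin : (Fᵀ * E * Z').trace = f + (Fᵀ * (E * W)).trace := by
    have : Z' = Z + W := by rw [hWdef]; abel
    rw [this, Matrix.mul_add, trace_add, Matrix.mul_assoc, Matrix.mul_assoc]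
  have hquad : (Fᵀ * ρ * F * Z').trace ≤ ‖ρ‖ * ‖Z'‖ * f := by
    have h1 := trace_mul_mono_right hZ'norm (conj_nonneg' hρ F)
    have h2 := trace_mul_mono_right (conj_mono' hρnorm F) one_nonneg'
    simp only [Matrix.mul_smul, Matrix.smul_mul, Matrix.one_mul, Matrix.mul_one, trace_smul,
      smul_eq_mul] at h1 h2
    nlinarith [norm_nonneg Z']
  have hquad2 : η * (‖ρ‖ * ‖Z'‖ * f) ≤ f / 4 := by
    have h1 : η * (‖ρ‖ * ‖Z'‖) ≤ η * (‖ρ‖ * (2 * ‖Z‖)) := by gcongr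
    nlinarith
  simp only [transpose_neg, transpose_smul, Matrix.neg_mul, Matrix.mul_neg, Matrix.smul_mul,
    Matrix.mul_smul, trace_neg, trace_smul, smul_eq_mul] at hsub
  rw [hlin] at hsub
  have h5 : η * (η * (Fᵀ * ρ * F * Z').trace) ≤ η * (f / 4) := by
    refine mul_le_mul_of_nonneg_left (le_trans ?_ hquad2) hη
    exact mul_le_mul_of_nonneg_left hquad hη
  have h6 := mul_le_mul_of_nonneg_left hcross hη
  have h7 := mul_le_mul_of_nonneg_left hef hη
  nlinarith

end LQR

/-! ### A priori bounds in terms of the cost, and the gradient descent step size -/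

namespace LQR

open scoped MatrixOrder

variable {d k : ℕ} {S : LQR d k} {K K₀ Kstar : Matrix (Fin k) (Fin d) ℝ}

theorem Regular.trace_stateCorr_le (h : S.Regular) (hK : S.Stabilizing K) :
    (S.stateCorr K).trace ≤ S.costR K / sigmaMin S.Q := by
  rw [le_div_iff₀ h.sigmaMin_Q_pos, h.costR_eq_trace_stateCorr hK]
  have := trace_mul_mono_left (h.sigmaMin_Q_smul_one_le K) (h.stateCorr_nonneg hK)
  simp only [Matrix.smul_mul, Matrix.one_mul, trace_smul, smul_eq_mul] at this
  linarith

theorem Regular.norm_stateCorr_le (h : S.Regular) (hK : S.Stabilizing K) :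
    ‖S.stateCorr K‖ ≤ S.costR K / sigmaMin S.Q :=
  (norm_le_trace (h.stateCorr_nonneg hK)).trans (h.trace_stateCorr_le hK)

theorem Regular.norm_valueMatrix_le (h : S.Regular) (hK : S.Stabilizing K) :
    ‖S.valueMatrix K‖ ≤ S.costR K / S.mu := by
  refine (norm_le_trace (h.valueMatrix_nonneg hK)).trans ?_
  rw [le_div_iff₀ h.mu_pos, h.costR_eq_trace_valueMatrix hK]
  have := trace_mul_mono_right h.mu_smul_one_le (h.valueMatrix_nonneg hK)
  simp only [Matrix.mul_smul, Matrix.mul_one, trace_smul, smul_eq_mul] at this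
  linarith

theorem Regular.norm_inputHess_le (h : S.Regular) (hK : S.Stabilizing K) :
    ‖S.inputHess K‖ ≤ ‖S.R‖ + ‖S.B‖ ^ 2 * (S.costR K / S.mu) := by
  refine (norm_add_le _ _).trans ?_
  gcongr
  calc ‖S.Bᵀ * S.valueMatrix K * S.B‖ ≤ ‖S.Bᵀ‖ * ‖S.valueMatrix K‖ * ‖S.B‖ :=
        (l2_opNorm_mul _ _).trans (by gcongr; exact l2_opNorm_mul _ _)
    _ = ‖S.B‖ ^ 2 * ‖S.valueMatrix K‖ := by rw [l2_opNorm_transpose]; ring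
    _ ≤ _ := by gcongr; exact h.norm_valueMatrix_le hK

theorem Regular.mu_mul_sigmaMin_Q_le (h : S.Regular) (hK : S.Stabilizing K) :
    S.mu * sigmaMin S.Q ≤ S.costR K := by
  rw [← le_div_iff₀ h.sigmaMin_Q_pos]
  exact (h.mu_le_norm_stateCorr hK).trans (h.norm_stateCorr_le hK)

/-- μ‖M‖² ≤ tr(MΣMᵀ) ≤ tr Σ, the last step by the Lyapunov equation of Σ. -/
theorem Regular.norm_loop_sq_le (h : S.Regular) (hK : S.Stabilizing K) :
    ‖S.loop K‖ ^ 2 ≤ S.costR K / (S.mu * sigmaMin S.Q) := by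
  have h1 : S.loop K * S.stateCorr K * (S.loop K)ᵀ ≤ S.stateCorr K := by
    conv_rhs => rw [h.stateCorr_eq hK, SqSummable.lyap_eq hK, ← h.stateCorr_eq hK]
    exact le_add_of_nonneg_left h.secondMoment_nonneg
  have h2 := norm_pow_sq_le_trace h.mu_pos (h.mu_smul_one_le_stateCorr hK) (S.loop K)
  have h3 := trace_nonneg_of_nonneg (sub_nonneg.2 h1)
  rw [trace_sub] at h3
  have h4 := h.trace_stateCorr_le hK
  calc _ ≤ S.mu⁻¹ * (S.costR K / sigmaMin S.Q) :=
        h2.trans (mul_le_mul_of_nonneg_left (by linarith) (inv_nonneg.2 h.mu_pos.le))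
    _ = _ := by field_simp

theorem Regular.norm_gain_sq_le (h : S.Regular) (hk : 0 < k) (hK : S.Stabilizing K) :
    ‖K‖ ^ 2 ≤ S.costR K / S.mu * (1 / sigmaMin S.R) := by
  have hσ := sigmaMin_pos hk h.R_posDef
  have h1 := conj_mono' (sigmaMin_smul_one_le h.R_nonneg) K
  have h2 : Kᵀ * S.R * K ≤ S.valueMatrix K :=
    (le_add_of_nonneg_left h.Q_posDef.posSemidef.nonneg).trans (h.stageCost_le_valueMatrix hK)
  simp only [Matrix.mul_smul, Matrix.smul_mul, Matrix.mul_one] at h1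
  have h3 := norm_mono (smul_nonneg_of_nonneg hσ.le (transpose_mul_self_nonneg K)) (h1.trans h2)
  rw [norm_smul, l2_opNorm_transpose_mul_self, Real.norm_of_nonneg hσ.le] at h3
  have h4 := h3.trans (h.norm_valueMatrix_le hK)
  rw [mul_one_div, le_div_iff₀ hσ]
  linarith

theorem gradFactor_eq (S : LQR d k) (K : Matrix (Fin k) (Fin d) ℝ) :
    S.gradFactor K = S.R * K - S.Bᵀ * S.valueMatrix K * S.loop K := by
  simp only [gradFactor, inputHess, loop, Matrix.mul_sub, Matrix.add_mul, Matrix.mul_assoc]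
  abel

theorem norm_gradFactor_le (S : LQR d k) (K : Matrix (Fin k) (Fin d) ℝ) :
    ‖S.gradFactor K‖ ≤ ‖S.R‖ * ‖K‖ + ‖S.B‖ * ‖S.valueMatrix K‖ * ‖S.loop K‖ := by
  rw [gradFactor_eq]
  refine (norm_sub_le _ _).trans (add_le_add (l2_opNorm_mul _ _) ?_)
  rw [← l2_opNorm_transpose S.B]
  exact (l2_opNorm_mul _ _).trans (by gcongr; exact l2_opNorm_mul _ _)

theorem norm_conj_sub_conj_le {n : Type*} [Fintype n] [DecidableEq n] (M N Z : Matrix n n ℝ) :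
    ‖(M - N) * Z * (M - N)ᵀ - M * Z * Mᵀ‖ ≤ (2 * ‖N‖ * ‖M‖ + ‖N‖ ^ 2) * ‖Z‖ := by
  have h1 : (M - N) * Z * (M - N)ᵀ - M * Z * Mᵀ =
      N * Z * Nᵀ - (N * Z * Mᵀ + M * Z * Nᵀ) := by
    simp only [transpose_sub, Matrix.sub_mul, Matrix.mul_sub]; abel
  have h2 : ∀ U V : Matrix n n ℝ, ‖U * Z * Vᵀ‖ ≤ ‖U‖ * ‖Z‖ * ‖V‖ := fun U V => by
    rw [← l2_opNorm_transpose V]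
    exact (norm_mul_le _ _).trans (by gcongr; exact norm_mul_le _ _)
  rw [h1]
  have h3 := norm_sub_le (N * Z * Nᵀ) (N * Z * Mᵀ + M * Z * Nᵀ)
  have h4 := norm_add_le (N * Z * Mᵀ) (M * Z * Nᵀ)
  linarith [h2 N N, h2 N M, h2 M N]

theorem norm_loop_gdStep_sub_le (h : S.Regular) (hK : S.Stabilizing K) {η : ℝ} (hη : 0 ≤ η) :
    ∃ N, S.loop (S.gdStep η K) = S.loop K - N ∧
      ‖N‖ ≤ ‖S.B‖ * (2 * η * (‖S.gradFactor K‖ * ‖S.stateCorr K‖)) := by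
  refine ⟨S.B * (S.gdStep η K - K), ?_, ?_⟩
  · rw [loop, loop, Matrix.mul_sub]; abel
  · refine (l2_opNorm_mul _ _).trans ?_
    gcongr
    rw [gdStep, h.grad_eq hK, smul_smul, sub_sub_cancel_left, norm_neg, norm_smul,
      Real.norm_of_nonneg (by positivity), mul_comm η]
    gcongr
    exact l2_opNorm_mul _ _

/-- The polynomial controlling the step size of gradient descent; `x`, `y`, `b`, `r`, `s` stand for
`C(K₀) / (μ σ_min(Q))`, `C(K₀) / μ`, `‖B‖`, `‖R‖` and `1 / σ_min(R)`. -/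
def gdPoly {R : Type*} [CommRing R] (x y b r s : R) : R :=
  1 + 8 * (r + b ^ 2 * y) + 144 * b * (r * (1 + y * s) + b * y * x) * x ^ 3

theorem one_le_gdPoly {x y b r s : ℝ} (hx : 0 ≤ x) (hy : 0 ≤ y) (hb : 0 ≤ b) (hr : 0 ≤ r)
    (hs : 0 ≤ s) : 1 ≤ gdPoly x y b r s := by
  rw [gdPoly, add_assoc]
  exact le_add_of_nonneg_right (by positivity)

/-- Here u, v, z, m play the norm of the loop change, ‖M‖, ‖Σ‖ and μ. As u ≤ x, 2ux + u² ≤ 3ux, and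
72 = 24 · 3. -/
theorem perturbation_bound {u v m z x δ : ℝ} (hu : 0 ≤ u) (hz : 0 ≤ z) (hm : 0 ≤ m)
    (hv : v ≤ x) (hzx : z ≤ m * x) (hx : 1 ≤ x) (hux : 72 * u * x ^ 3 ≤ 1)
    (hδ : δ ≤ (2 * u * v + u ^ 2) * z) : 24 * δ * z ≤ m ^ 2 := by
  have hx3 : 1 ≤ x ^ 3 := one_le_pow₀ hx
  have hux' : u ≤ x := by nlinarith
  have hx0 : 0 ≤ x := by linarith
  calc 24 * δ * z ≤ 24 * ((2 * u * v + u ^ 2) * z) * z := by gcongr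
    _ ≤ 24 * ((2 * u * x + u * x) * (m * x)) * (m * x) := by
        rw [sq u]; gcongr
    _ = (72 * u * x ^ 3) * m ^ 2 := by ring
    _ ≤ 1 * m ^ 2 := by gcongr
    _ = m ^ 2 := one_mul _

/-- One step size serves the whole sublevel set C(K) ≤ C. The summand 8(r + b²y) of `gdPoly`
controls η‖ρ‖‖Σ‖; the summand with 144 = 2 · 72 controls the change of the loop, whose size is at
most 2b‖E‖ · η‖Σ‖. -/
theorem Regular.gdStep_descent_of_step_size (h : S.Regular) (hk : 0 < k) (hK : S.Stabilizing K)
    {C η : ℝ} (hC : S.costR K ≤ C)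
    (hη : η = 1 / (C / sigmaMin S.Q * gdPoly (C / (S.mu * sigmaMin S.Q)) (C / S.mu) ‖S.B‖ ‖S.R‖
      (1 / sigmaMin S.R))) :
    S.Stabilizing (S.gdStep η K) ∧ S.costR (S.gdStep η K) ≤ S.costR K -
      2 * η * S.mu ^ 2 * ((S.gradFactor K)ᵀ * S.gradFactor K).trace := by
  have hμ := h.mu_pos
  have hσQ := h.sigmaMin_Q_pos
  have hσR := sigmaMin_pos hk h.R_posDef
  have hK0 : 0 ≤ S.costR K := ENNReal.toReal_nonneg
  have hC0 : 0 ≤ C := hK0.trans hC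
  set x := C / (S.mu * sigmaMin S.Q) with hx
  set y := C / S.mu with hy
  set b := ‖S.B‖ with hb
  set r := ‖S.R‖ with hr
  set s := 1 / sigmaMin S.R with hs
  have hy0 : 0 ≤ y := by positivity
  have hb0 : 0 ≤ b := norm_nonneg _
  have hr0 : 0 ≤ r := norm_nonneg _
  have hs0 : 0 ≤ s := by positivity
  have hx1 : 1 ≤ x := by
    rw [hx, one_le_div (by positivity)]
    exact (h.mu_mul_sigmaMin_Q_le hK).trans hC
  have hx0 : 0 ≤ x := by linarith
  have hxC : C / sigmaMin S.Q = S.mu * x := by rw [hx]; field_simp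
  rw [hxC] at hη
  have hg := one_le_gdPoly hx0 hy0 hb0 hr0 hs0
  set g := gdPoly x y b r s with hgdef
  have hg0 : 0 < g := by linarith
  have hη0 : 0 ≤ η := by rw [hη]; positivity
  have hηg : η * (S.mu * x) = 1 / g := by rw [hη]; field_simp
  have hZ : ‖S.stateCorr K‖ ≤ S.mu * x := by
    rw [← hxC]; exact (h.norm_stateCorr_le hK).trans (by gcongr)
  have hM : ‖S.loop K‖ ≤ x := by
    have h1 : ‖S.loop K‖ ^ 2 ≤ x := (h.norm_loop_sq_le hK).trans (by rw [hx]; gcongr)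
    nlinarith [norm_nonneg (S.loop K)]
  -- The bound t ≤ 1 + t² replaces a square root, to stay polynomial.
  have hKn : ‖K‖ ≤ 1 + y * s := by
    have h1 : ‖K‖ ^ 2 ≤ y * s := (h.norm_gain_sq_le hk hK).trans (by rw [hy]; gcongr)
    nlinarith [sq_nonneg (‖K‖ - 1)]
  have hP : ‖S.valueMatrix K‖ ≤ y := (h.norm_valueMatrix_le hK).trans (by rw [hy]; gcongr)
  have hρ : ‖S.inputHess K‖ ≤ r + b ^ 2 * y :=
    (h.norm_inputHess_le hK).trans (by rw [hy]; gcongr)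
  have hE : ‖S.gradFactor K‖ ≤ r * (1 + y * s) + b * y * x :=
    (norm_gradFactor_le S K).trans (by gcongr)
  set e := r * (1 + y * s) + b * y * x with he
  have he0 : 0 ≤ e := by positivity
  have hg1 : 8 * (r + b ^ 2 * y) ≤ g := by
    have : 0 ≤ 144 * b * e * x ^ 3 := by positivity
    rw [hgdef, gdPoly]; linarith
  have hg2 : 144 * b * e * x ^ 3 ≤ g := by
    have : 0 ≤ 8 * (r + b ^ 2 * y) := by positivity
    rw [hgdef, gdPoly]; linarith
  refine h.gdStep_descent hK hη0 ?_ ?_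
  · obtain ⟨N, hN, hNle⟩ := norm_loop_gdStep_sub_le h hK hη0
    have hN1 : ‖N‖ ≤ 2 * b * e / g := by
      calc ‖N‖ ≤ b * (2 * η * (e * (S.mu * x))) := hNle.trans (by gcongr)
        _ = 2 * b * e * (η * (S.mu * x)) := by ring
        _ = _ := by rw [hηg]; ring
    have hN2 : 72 * ‖N‖ * x ^ 3 ≤ 1 := by
      calc 72 * ‖N‖ * x ^ 3 ≤ 72 * (2 * b * e / g) * x ^ 3 := by gcongr
        _ = 144 * b * e * x ^ 3 / g := by ring
        _ ≤ 1 := by rwa [div_le_one hg0]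
    rw [hN]
    exact perturbation_bound (norm_nonneg N) (norm_nonneg _) hμ.le hM hZ hx1 hN2
      (norm_conj_sub_conj_le _ _ _)
  · calc 8 * η * ‖S.inputHess K‖ * ‖S.stateCorr K‖ ≤ 8 * η * (r + b ^ 2 * y) * (S.mu * x) := by
          gcongr
      _ = 8 * (r + b ^ 2 * y) * (η * (S.mu * x)) := by ring
      _ = 8 * (r + b ^ 2 * y) / g := by rw [hηg]; ring
      _ ≤ 1 := by rwa [div_le_one hg0]

/-! ### From one-step contraction to iteration counts -/

theorem Regular.costR_le_of_isMin (h : S.Regular) (hmin : ∀ K, S.cost Kstar ≤ S.cost K)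
    (hK : S.Stabilizing K) : S.costR Kstar ≤ S.costR K :=
  ENNReal.toReal_mono (h.stabilizing_iff.1 hK) (hmin K)

theorem sub_le_of_domination {D D' a c e L : ℝ} (hL : 0 < L) (hdesc : D' ≤ D - a * e)
    (hdom : D ≤ c * e) (hca : c ≤ a * L) (he : 0 ≤ e) : D' ≤ (1 - 1 / L) * D := by
  have h1 : D ≤ a * L * e := hdom.trans (by gcongr)
  have h2 : D / L ≤ a * e := by rw [div_le_iff₀ hL]; linarith
  have h3 : (1 - 1 / L) * D = D - D / L := by ring
  linarith

/-- The contraction is needed only on the sublevel set of K₀. Stability is carried through the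
induction because `costR` is 0 at infinite cost. -/
theorem Regular.iterate_bound (h : S.Regular) (hmin : ∀ K, S.cost Kstar ≤ S.cost K)
    (hK₀ : S.Stabilizing K₀) {step : Matrix (Fin k) (Fin d) ℝ → Matrix (Fin k) (Fin d) ℝ} {L : ℝ}
    (hL : 0 < L)
    (hstep : ∀ K, S.Stabilizing K → S.costR K ≤ S.costR K₀ → S.Stabilizing (step K) ∧
      S.costR (step K) - S.costR Kstar ≤ (1 - 1 / L) * (S.costR K - S.costR Kstar))
    {ε : ℝ} {N : ℕ} (hε : 0 < ε)
    (hN : L * Real.log ((S.costR K₀ - S.costR Kstar) / ε) ≤ N) :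
    S.cost (step^[N] K₀) ≠ ∞ ∧ S.costR (step^[N] K₀) - S.costR Kstar ≤ ε := by
  have hD0 : 0 ≤ S.costR K₀ - S.costR Kstar := sub_nonneg.2 (h.costR_le_of_isMin hmin hK₀)
  have key : ∀ n : ℕ, S.Stabilizing (step^[n] K₀) ∧ S.costR (step^[n] K₀) ≤ S.costR K₀ ∧
      S.costR (step^[n] K₀) - S.costR Kstar ≤
        Real.exp (-(n / L)) * (S.costR K₀ - S.costR Kstar) := by
    intro n
    induction n with
    | zero => simpa using hK₀
    | succ n ih =>
      obtain ⟨hs, hle, hD⟩ := ih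
      rw [Function.iterate_succ_apply']
      obtain ⟨hs', hD'⟩ := hstep _ hs hle
      have hDn : 0 ≤ S.costR (step^[n] K₀) - S.costR Kstar :=
        sub_nonneg.2 (h.costR_le_of_isMin hmin hs)
      refine ⟨hs', ?_, ?_⟩
      · have : 0 ≤ 1 / L * (S.costR (step^[n] K₀) - S.costR Kstar) := by positivity
        linarith
      · calc _ ≤ (1 - 1 / L) * (S.costR (step^[n] K₀) - S.costR Kstar) := hD'
          _ ≤ Real.exp (-(1 / L)) * (S.costR (step^[n] K₀) - S.costR Kstar) := by
              gcongr; linarith [Real.add_one_le_exp (-(1 / L))]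
          _ ≤ Real.exp (-(1 / L)) *
                (Real.exp (-(n / L)) * (S.costR K₀ - S.costR Kstar)) := by gcongr
          _ = _ := by
              rw [← mul_assoc, ← Real.exp_add]
              congr 2
              push_cast
              ring
  obtain ⟨hs, -, hD⟩ := key N
  refine ⟨h.stabilizing_iff.1 hs, hD.trans ?_⟩
  -- If K₀ is optimal, the hypothesis involves the default value log 0 = 0 and says nothing; the
  -- bound is then immediate.
  rcases hD0.eq_or_lt with h0 | h0
  · rw [← h0]; simpa using hε.le
  · have h1 : Real.log ((S.costR K₀ - S.costR Kstar) / ε) ≤ N / L := by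
      rw [le_div_iff₀ hL]; linarith
    have h2 := (Real.log_le_iff_le_exp (by positivity)).1 h1
    rw [div_le_iff₀ hε] at h2
    rw [Real.exp_neg, inv_mul_le_iff₀ (Real.exp_pos _)]
    exact h2

theorem cost_of_subsingleton [Subsingleton (Matrix (Fin k) (Fin d) ℝ)] (hK₀ : S.cost K₀ ≠ ∞)
    (K : Matrix (Fin k) (Fin d) ℝ) {ε : ℝ} (hε : 0 < ε) :
    S.cost K ≠ ∞ ∧ S.costR K - S.costR Kstar ≤ ε := by
  rw [Subsingleton.elim K K₀, Subsingleton.elim Kstar K₀, sub_self]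
  exact ⟨hK₀, hε.le⟩

theorem Regular.gauss_newton (h : S.Regular) (hmin : ∀ K, S.cost Kstar ≤ S.cost K)
    (hK₀ : S.Stabilizing K₀) {ε : ℝ} {N : ℕ} (hε : 0 < ε)
    (hN : ‖S.stateCorr Kstar‖ / S.mu * Real.log ((S.costR K₀ - S.costR Kstar) / ε) ≤ N) :
    S.cost ((S.gnStep 1)^[N] K₀) ≠ ∞ ∧
      S.costR ((S.gnStep 1)^[N] K₀) - S.costR Kstar ≤ ε := by
  have hμ := h.mu_pos
  have hstar : S.Stabilizing Kstar :=
    h.stabilizing_iff.2 (ne_top_of_le_ne_top (h.stabilizing_iff.1 hK₀) (hmin K₀))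
  have hZ := hμ.trans_le (h.mu_le_norm_stateCorr hstar)
  refine h.iterate_bound hmin hK₀ (by positivity) (fun K hK _ => ?_) hε hN
  obtain ⟨h1, h2⟩ := h.gnStep_descent hK
  refine ⟨h1, sub_le_of_domination (a := S.mu) (by positivity) (by linarith)
    (h.gradient_domination_inv hK hstar) (le_of_eq (by field_simp)) ?_⟩
  exact trace_nonneg_of_nonneg (conj_nonneg' (PosSemidef.inv
    (h.inputHess_nonneg hK).posSemidef).nonneg _)

theorem Regular.sigmaMin_R_le_norm (h : S.Regular) (hk : 0 < k) : sigmaMin S.R ≤ ‖S.R‖ := by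
  have : Nonempty (Fin k) := ⟨⟨0, hk⟩⟩
  have h1 := norm_mono (smul_nonneg_of_nonneg (sigmaMin_nonneg S.R) one_nonneg')
    (sigmaMin_smul_one_le h.R_nonneg)
  rwa [norm_smul, CStarRing.norm_one, mul_one, Real.norm_of_nonneg (sigmaMin_nonneg _)] at h1

theorem Regular.natural_policy_gradient (h : S.Regular) (hk : 0 < k)
    (hmin : ∀ K, S.cost Kstar ≤ S.cost K) (hK₀ : S.Stabilizing K₀) {η : ℝ}
    (hη : η = 1 / (‖S.R‖ + ‖S.B‖ ^ 2 * S.costR K₀ / S.mu)) {ε : ℝ} {N : ℕ} (hε : 0 < ε)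
    (hN : ‖S.stateCorr Kstar‖ / S.mu *
      (‖S.R‖ / sigmaMin S.R + ‖S.B‖ ^ 2 * S.costR K₀ / (S.mu * sigmaMin S.R)) *
      Real.log ((S.costR K₀ - S.costR Kstar) / ε) ≤ N) :
    S.cost ((S.npgStep η)^[N] K₀) ≠ ∞ ∧
      S.costR ((S.npgStep η)^[N] K₀) - S.costR Kstar ≤ ε := by
  have hμ := h.mu_pos
  have hσR := sigmaMin_pos hk h.R_posDef
  have hR := hσR.trans_le (h.sigmaMin_R_le_norm hk)
  have hstar : S.Stabilizing Kstar :=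
    h.stabilizing_iff.2 (ne_top_of_le_ne_top (h.stabilizing_iff.1 hK₀) (hmin K₀))
  have hZ := hμ.trans_le (h.mu_le_norm_stateCorr hstar)
  have hC0 : 0 ≤ S.costR K₀ := ENNReal.toReal_nonneg
  have hη0 : 0 < η := by rw [hη]; positivity
  refine h.iterate_bound hmin hK₀ (by positivity) (fun K hK hle => ?_) hε hN
  obtain ⟨h1, h2⟩ := h.npgStep_descent hK hη0.le (by
    rw [hη, one_div_mul_eq_div, div_le_one (by positivity)]
    refine (h.norm_inputHess_le hK).trans ?_
    rw [mul_div_assoc]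
    gcongr)
  refine ⟨h1, sub_le_of_domination (a := S.mu * η) (e := ((S.gradFactor K)ᵀ * S.gradFactor K).trace)
    (c := ‖S.stateCorr Kstar‖ * (sigmaMin S.R)⁻¹) (by positivity) (by linarith)
    ?_ (le_of_eq ?_) (trace_nonneg_of_nonneg (transpose_mul_self_nonneg _))⟩
  · rw [mul_assoc]; exact h.gradient_domination hk hK hstar
  · rw [hη]; field_simp

theorem Regular.gradient_descent (h : S.Regular) (hk : 0 < k)
    (hmin : ∀ K, S.cost Kstar ≤ S.cost K) (hK₀ : S.Stabilizing K₀) {g η : ℝ}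
    (hg : g = gdPoly (S.costR K₀ / (S.mu * sigmaMin S.Q)) (S.costR K₀ / S.mu) ‖S.B‖ ‖S.R‖
      (1 / sigmaMin S.R))
    (hη : η = 1 / (S.costR K₀ / sigmaMin S.Q * g)) {ε : ℝ} {N : ℕ} (hε : 0 < ε)
    (hN : ‖S.stateCorr Kstar‖ / S.mu * Real.log ((S.costR K₀ - S.costR Kstar) / ε) *
      (S.costR K₀ / (S.mu * sigmaMin S.Q) * g * (1 / sigmaMin S.R)) ≤ N) :
    S.cost ((S.gdStep η)^[N] K₀) ≠ ∞ ∧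
      S.costR ((S.gdStep η)^[N] K₀) - S.costR Kstar ≤ ε := by
  have hμ := h.mu_pos
  have hσQ := h.sigmaMin_Q_pos
  have hσR := sigmaMin_pos hk h.R_posDef
  have hstar : S.Stabilizing Kstar :=
    h.stabilizing_iff.2 (ne_top_of_le_ne_top (h.stabilizing_iff.1 hK₀) (hmin K₀))
  have hZ := hμ.trans_le (h.mu_le_norm_stateCorr hstar)
  have hC0 : 0 < S.costR K₀ := lt_of_lt_of_le (by positivity) (h.mu_mul_sigmaMin_Q_le hK₀)
  have hg0 : 0 < g := by
    rw [hg]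
    exact one_pos.trans_le (one_le_gdPoly (by positivity) (by positivity) (norm_nonneg _)
      (norm_nonneg _) (by positivity))
  have hη0 : 0 < η := by rw [hη]; positivity
  rw [mul_right_comm] at hN
  refine h.iterate_bound hmin hK₀ (by positivity) (fun K hK hle => ?_) hε hN
  obtain ⟨h1, h2⟩ := h.gdStep_descent_of_step_size (η := η) hk hK hle (by rw [← hg]; exact hη)
  refine ⟨h1, sub_le_of_domination (a := 2 * η * S.mu ^ 2)
    (e := ((S.gradFactor K)ᵀ * S.gradFactor K).trace)
    (c := ‖S.stateCorr Kstar‖ * (sigmaMin S.R)⁻¹) (by positivity) (by linarith)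
    ?_ ?_ (trace_nonneg_of_nonneg (transpose_mul_self_nonneg _))⟩
  · rw [mul_assoc]; exact h.gradient_domination hk hK hstar
  -- The product is twice what domination requires.
  · have : 2 * η * S.mu ^ 2 * (‖S.stateCorr Kstar‖ / S.mu *
        (S.costR K₀ / (S.mu * sigmaMin S.Q) * g * (1 / sigmaMin S.R))) =
        2 * (‖S.stateCorr Kstar‖ * (sigmaMin S.R)⁻¹) := by
      rw [hη]; field_simp
    rw [this]
    have : 0 ≤ ‖S.stateCorr Kstar‖ * (sigmaMin S.R)⁻¹ := by positivity
    linarith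

end LQR

/-! ### Choice of the universal polynomials -/

theorem theorem1 :
    ∃ (p : MvPolynomial (Fin 7) ℝ) (q : MvPolynomial (Fin 6) ℝ),
    ∀ (d k : ℕ) (S : LQR d k), S.Q.PosDef → S.R.PosDef → IsProbabilityMeasure S.D →
    ∀ (Kstar : Matrix (Fin k) (Fin d) ℝ), (∀ K, S.cost Kstar ≤ S.cost K) →
    ∀ (K₀ : Matrix (Fin k) (Fin d) ℝ), S.cost K₀ ≠ ∞ → 0 < S.mu →
      -- Gauss-Newton
      (∀ (ε : ℝ) (N : ℕ), 0 < ε →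
        ‖S.stateCorr Kstar‖ / S.mu * Real.log ((S.costR K₀ - S.costR Kstar) / ε) ≤ N →
        S.cost ((S.gnStep 1)^[N] K₀) ≠ ∞ ∧
        S.costR ((S.gnStep 1)^[N] K₀) - S.costR Kstar ≤ ε) ∧
      -- natural policy gradient
      (∀ (η : ℝ), η = 1 / (‖S.R‖ + ‖S.B‖ ^ 2 * S.costR K₀ / S.mu) →
        ∀ (ε : ℝ) (N : ℕ), 0 < ε →
        ‖S.stateCorr Kstar‖ / S.mu *
          (‖S.R‖ / sigmaMin S.R + ‖S.B‖ ^ 2 * S.costR K₀ / (S.mu * sigmaMin S.R)) *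
          Real.log ((S.costR K₀ - S.costR Kstar) / ε) ≤ N →
        S.cost ((S.npgStep η)^[N] K₀) ≠ ∞ ∧
        S.costR ((S.npgStep η)^[N] K₀) - S.costR Kstar ≤ ε) ∧
      -- gradient descent
      (∀ (η : ℝ), η = 1 / MvPolynomial.eval ![S.costR K₀, 1 / S.mu, 1 / sigmaMin S.Q,
            ‖S.A‖, ‖S.B‖, ‖S.R‖, 1 / sigmaMin S.R] p →
        0 < η ∧
        ∀ (ε : ℝ) (N : ℕ), 0 < ε →
        ‖S.stateCorr Kstar‖ / S.mu * Real.log ((S.costR K₀ - S.costR Kstar) / ε) *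
          MvPolynomial.eval ![S.costR K₀ / (S.mu * sigmaMin S.Q), S.costR K₀ / S.mu,
            ‖S.A‖, ‖S.B‖, ‖S.R‖, 1 / sigmaMin S.R] q ≤ N →
        S.cost ((S.gdStep η)^[N] K₀) ≠ ∞ ∧
        S.costR ((S.gdStep η)^[N] K₀) - S.costR Kstar ≤ ε) := by
  -- With g the value of `gdPoly`, p evaluates to (C(K₀)/σ_min(Q)) g and q to (C(K₀)/(μ σ_min(Q))) g
  -- / σ_min(R).
  refine ⟨MvPolynomial.X 0 * MvPolynomial.X 2 * LQR.gdPoly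
      (MvPolynomial.X 0 * MvPolynomial.X 1 * MvPolynomial.X 2)
      (MvPolynomial.X 0 * MvPolynomial.X 1) (MvPolynomial.X 4) (MvPolynomial.X 5)
      (MvPolynomial.X 6),
    MvPolynomial.X 0 * LQR.gdPoly (MvPolynomial.X 0) (MvPolynomial.X 1) (MvPolynomial.X 3)
      (MvPolynomial.X 4) (MvPolynomial.X 5) * MvPolynomial.X 5, ?_⟩
  intro d k S hQ hR _ Kstar hmin K₀ hK₀ hμ
  have h : S.Regular :=
    ⟨hQ, hR, LQR.integrable_of_cost_ne_top (pos_of_sigmaMin_pos hμ) hQ hR hK₀, hμ⟩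
  have hstab := h.stabilizing_iff.2 hK₀
  have hσQ := h.sigmaMin_Q_pos
  have hC0 : 0 < S.costR K₀ := lt_of_lt_of_le (by positivity) (h.mu_mul_sigmaMin_Q_le hstab)
  refine ⟨fun ε N hε hN => h.gauss_newton hmin hstab hε hN, fun η hη ε N hε hN => ?_,
    fun η hη => ?_⟩
  · rcases Nat.eq_zero_or_pos k with rfl | hk
    -- For k = 0 there is only one gain matrix, so every iterate equals the minimizer.
    · exact LQR.cost_of_subsingleton hK₀ _ hε
    · exact h.natural_policy_gradient hk hmin hstab hη hε hN
  · set g := LQR.gdPoly (S.costR K₀ / (S.mu * sigmaMin S.Q)) (S.costR K₀ / S.mu) ‖S.B‖ ‖S.R‖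
      (1 / sigmaMin S.R) with hg
    have hg1 : 1 ≤ g := LQR.one_le_gdPoly (by positivity) (by positivity) (norm_nonneg _)
      (norm_nonneg _) (one_div_nonneg.2 (sigmaMin_nonneg _))
    have hη' : η = 1 / (S.costR K₀ / sigmaMin S.Q * g) := by
      rw [hη, hg]
      congr 1
      simp only [LQR.gdPoly, map_mul, map_add, map_pow, map_one, map_ofNat, MvPolynomial.eval_X]
      simp
      ring
    refine ⟨by rw [hη']; positivity, fun ε N hε hN => ?_⟩
    rcases Nat.eq_zero_or_pos k with rfl | hk
    · exact LQR.cost_of_subsingleton hK₀ _ hε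
    · refine h.gradient_descent hk hmin hstab hg hη' hε (le_of_eq_of_le ?_ hN)
      congr 1
      rw [hg]
      simp [LQR.gdPoly]
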